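/- Let $M$ and $W$ be sets of $n$ men and $n$ women, let $\succ$ be a preference profile in which every agent has a strict total order over all agents of the other side, and fix a man $m \in M$ (the accomplice). Write $\mathrm{DA}(\cdot)$ for the matching computed by the men-proposing deferred acceptance algorithm and let $\mu = \mathrm{DA}(\succ)$. A strategy of $m$ is a list $\succ'_m$ over $W$; put $\mu' = \mathrm{DA}(\succ_{-m}, \succ'_m)$. It is no-regret if $\mu'(m) \succeq_m \mu(m)$. It is an optimal one-for-all strategy if it is no-regret, every woman weakly prefers $\mu'$ to $\mu$, and every woman weakly prefers $\mu'$ to $\mathrm{DA}(\succ_{-m}, \succ''_m)$ for every no-regret strategy $\succ''_m$ (all with respect to the true lists). It pushes up the women who are below $\mu(m)$ in $\succ_m$ and above $\mu(m)$ in $\succ'_m$. An optimal one-for-all strategy is minimum if no optimal one-for-all strategy pushes up fewer women. For $X \subseteq W$ let $\succ_m^{X\uparrow}$ be the list obtained from $\succ_m$ by moving the women of $X$ who are below $\mu(m)$ to places just above $\mu(m)$, in their original order, let $\mu^X = \mathrm{DA}(\succ_{-m}, \succ_m^{X\uparrow})$, and let $W^{\mathrm{NR}}$ be the set of all $w \in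 W$ for which $\succ_m^{\{w\}\uparrow}$ is no-regret. A set $Y \subseteq W^{\mathrm{NR}}$ is a minimum no-regret push up set if $\mu^Y = \mu^{W^{\mathrm{NR}}}$ and $|Y| \le |Z|$ for all $Z \subseteq W^{\mathrm{NR}}$ with $\mu^Z = \mu^{W^{\mathrm{NR}}}$. Consider the following greedy algorithm. Start with $Y = W^{\mathrm{NR}}$. Go through the women $w \in Y$; whenever $\mu^{Y \setminus \{w\}} = \mu^{W^{\mathrm{NR}}}$, replace $Y$ by $Y \setminus \{w\}$ and restart. When no $w \in Y$ can be removed, return $Y$. (1) In whatever order the women are tried, every set $Y$ returned by this algorithm is a minimum no-regret push up set, and $\succ_m^{Y\uparrow}$ is a minimum optimal one-for-all strategy of $m$. (2) The algorithm computes a minimum optimal one-for-all strategy in $O(n^4)$ time: an explicit implementation of it on a unit-cost random access machine (whose only arithmetic operations are successor and comparison), given the preference lists and $m$, terminates after at most $C n^4$ steps, with a constant $C$ that does not depend on $n$, $\succ$ or $m$, and outputs a set $Y$ that the algorithm may return, together with the list $\succ_m^{Y\uparrow}$. -/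

import Mathlib

namespace StableMarriage

/-! ## Preference lists, profiles -/

/-- A preference list: a strict total order on `Fin n`, written from best to worst. -/
structure PrefList (n : ℕ) where
  toList : List (Fin n)
  nodup : toList.Nodup
  mem : ∀ a, a ∈ toList

/-- `a` is ranked strictly above `b`. -/
def PrefList.Prefers {n : ℕ} (l : PrefList n) (a b : Fin n) : Prop :=
  l.toList.idxOf a < l.toList.idxOf b

instance {n : ℕ} (l : PrefList n) (a b : Fin n) : Decidable (l.Prefers a b) :=
  inferInstanceAs (Decidable (_ < _))

/-- `a` is ranked strictly above `b`, or equals `b`. -/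
def PrefList.WeaklyPrefers {n : ℕ} (l : PrefList n) (a b : Fin n) : Prop :=
  l.Prefers a b ∨ a = b

/-- A preference profile of `n` men and `n` women, both indexed by `Fin n`. -/
structure Profile (n : ℕ) where
  men : Fin n → PrefList n
  women : Fin n → PrefList n

/-! ## The deferred acceptance algorithm

The state records how many women have rejected each man. As a man goes down his list, his current
proposal is to the first woman who has not rejected him, i.e. to the entry at that position. -/

/-- The woman to whom `m` currently proposes (or is tentatively engaged); `none` if everyone
has rejected him. -/
def proposal {n : ℕ} (P : Profile n) (k : Fin n → ℕ) (m : Fin n) : Option (Fin n) :=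
  (P.men m).toList[k m]?

/-- The woman to whom `m` currently proposes has another current proposal that she prefers. -/
def Rejected {n : ℕ} (P : Profile n) (k : Fin n → ℕ) (m : Fin n) : Prop :=
  ∃ w, proposal P k m = some w ∧ ∃ m', proposal P k m' = some w ∧ (P.women w).Prefers m' m

instance {n : ℕ} (P : Profile n) (k : Fin n → ℕ) (m : Fin n) : Decidable (Rejected P k m) :=
  inferInstanceAs (Decidable (∃ _, _))

/-- One round: every woman keeps her favourite current proposal and rejects all the others. -/
def daRound {n : ℕ} (P : Profile n) (k : Fin n → ℕ) : Fin n → ℕ :=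
  fun m => if Rejected P k m then k m + 1 else k m

/-- The final state. There are at most `n * n` rejections, so that `n * n` rounds suffice
(see `daRound_daState`: nobody is rejected any more). -/
def daState {n : ℕ} (P : Profile n) : Fin n → ℕ :=
  (daRound P)^[n * n] (fun _ => 0)

theorem PrefList.length_eq {n : ℕ} (l : PrefList n) : l.toList.length = n := by
  have h := List.toFinset_card_of_nodup l.nodup
  have h2 : l.toList.toFinset = Finset.univ := by
    ext a; simp [l.mem a]
  rw [h2] at h
  simpa using h.symm

theorem PrefList.idxOf_inj {n : ℕ} (l : PrefList n) {a b : Fin n}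
    (h : l.toList.idxOf a = l.toList.idxOf b) : a = b :=
  (List.idxOf_inj (l.mem a)).1 h

theorem proposal_eq_some_iff {n : ℕ} (P : Profile n) (k : Fin n → ℕ) (m w : Fin n) :
    proposal P k m = some w ↔ (P.men m).toList.idxOf w = k m := by
  unfold proposal
  constructor
  · intro h
    obtain ⟨hk, h⟩ := List.getElem?_eq_some_iff.1 h
    rw [← h]
    exact (P.men m).nodup.idxOf_getElem _ hk
  · intro h
    rw [← h]
    have h1 : (P.men m).toList.idxOf w < (P.men m).toList.length :=
      List.idxOf_lt_length_iff.2 ((P.men m).mem w)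
    rw [List.getElem?_eq_getElem h1, List.getElem_idxOf]

/-- Invariant of deferred acceptance: whoever has rejected a man holds a proposal that she
prefers; and the counters never exceed `n`. -/
def DAInvariant {n : ℕ} (P : Profile n) (k : Fin n → ℕ) : Prop :=
  (∀ m, k m ≤ n) ∧ ∀ m w, (P.men m).toList.idxOf w < k m →
    ∃ m', proposal P k m' = some w ∧ (P.women w).Prefers m' m

theorem daInvariant_daRound {n : ℕ} (P : Profile n) (k : Fin n → ℕ) (hk : DAInvariant P k) :
    DAInvariant P (daRound P k) := by
  obtain ⟨h1, h2⟩ := hk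
  -- a woman with a current proposal keeps her favourite one
  have key : ∀ w m, proposal P k m = some w →
      ∃ m', proposal P (daRound P k) m' = some w ∧ (P.women w).WeaklyPrefers m' m := by
    intro w m hm
    classical
    obtain ⟨b, hb, hmin⟩ := Finset.exists_min_image
      (Finset.univ.filter (fun b => proposal P k b = some w))
      (fun b => (P.women w).toList.idxOf b) ⟨m, by simp [hm]⟩
    simp only [Finset.mem_filter, Finset.mem_univ, true_and] at hb hmin
    refine ⟨b, ?_, ?_⟩
    · have hnr : ¬ Rejected P k b := by
        rintro ⟨w', hw', m', hm', hp⟩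
        rw [hb] at hw'
        cases hw'
        exact absurd (hmin m' hm') (not_le.2 hp)
      unfold proposal daRound
      rw [if_neg hnr]
      exact hb
    · rcases (hmin m hm).lt_or_eq with h | h
      · exact Or.inl h
      · exact Or.inr ((P.women w).idxOf_inj h)
  refine ⟨?_, ?_⟩
  · intro m
    unfold daRound
    split_ifs with h
    · obtain ⟨w, hw, -⟩ := h
      rw [proposal_eq_some_iff] at hw
      have : (P.men m).toList.idxOf w < (P.men m).toList.length :=
        List.idxOf_lt_length_iff.2 ((P.men m).mem w)
      rw [PrefList.length_eq] at this
      omega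
    · exact h1 m
  · intro m w hlt
    have : ∃ m', proposal P k m' = some w ∧ (P.women w).Prefers m' m := by
      by_cases hm : (P.men m).toList.idxOf w < k m
      · exact h2 m w hm
      · unfold daRound at hlt
        split_ifs at hlt with h
        · obtain ⟨w', hw', h'⟩ := h
          have h3 := (proposal_eq_some_iff P k m w').1 hw'
          have : w' = w := (P.men m).idxOf_inj (by omega)
          subst this
          exact h'
        · exact absurd hlt hm
    obtain ⟨m', hm', hp⟩ := this
    obtain ⟨b, hb, hbm⟩ := key w m' hm'
    refine ⟨b, hb, ?_⟩
    rcases hbm with h | h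
    · exact lt_trans h hp
    · rw [h]; exact hp

theorem daInvariant_iterate {n : ℕ} (P : Profile n) (t : ℕ) :
    DAInvariant P ((daRound P)^[t] (fun _ => 0)) := by
  induction t with
  | zero => exact ⟨fun _ => Nat.zero_le _, fun m w h => absurd h (Nat.not_lt_zero _)⟩
  | succ t ih =>
    rw [Function.iterate_succ_apply']
    exact daInvariant_daRound P _ ih

theorem le_daRound {n : ℕ} (P : Profile n) (k : Fin n → ℕ) (m : Fin n) :
    k m ≤ daRound P k m := by
  unfold daRound; split_ifs <;> omega

theorem iterate_sum {n : ℕ} (P : Profile n) (t : ℕ) :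
    daRound P ((daRound P)^[t] (fun _ => 0)) = (daRound P)^[t] (fun _ => 0) ∨
      t + 1 ≤ ∑ m, daRound P ((daRound P)^[t] (fun _ => 0)) m := by
  have strict : ∀ k : Fin n → ℕ, daRound P k = k ∨ ∑ m, k m + 1 ≤ ∑ m, daRound P k m := by
    intro k
    by_cases h : daRound P k = k
    · exact Or.inl h
    · right
      obtain ⟨m, hm⟩ := Function.ne_iff.1 h
      exact Finset.sum_lt_sum (fun i _ => le_daRound P k i)
        ⟨m, Finset.mem_univ _, lt_of_le_of_ne (le_daRound P k m) (Ne.symm hm)⟩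
  induction t with
  | zero =>
    rcases strict (fun _ => 0) with h | h
    · exact Or.inl h
    · right; simp only [Function.iterate_zero, id]; omega
  | succ t ih =>
    rw [Function.iterate_succ_apply']
    rcases ih with h | h
    · left; rw [h, h]
    · rcases strict (daRound P ((daRound P)^[t] (fun _ => 0))) with h' | h'
      · exact Or.inl h'
      · right; omega

/-- Deferred acceptance has terminated in the state `daState P`. -/
theorem daRound_daState {n : ℕ} (P : Profile n) : daRound P (daState P) = daState P := by
  rcases iterate_sum P (n * n) with h | h
  · exact h
  · exfalso
    have h1 : ∑ m, daRound P ((daRound P)^[n * n] (fun _ => 0)) m ≤ ∑ _m : Fin n, n := by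
      apply Finset.sum_le_sum
      intro i _
      have := (daInvariant_iterate P (n * n + 1)).1 i
      rwa [Function.iterate_succ_apply'] at this
    simp only [Finset.sum_const, Finset.card_univ, Fintype.card_fin, smul_eq_mul] at h1
    omega

theorem not_rejected_daState {n : ℕ} (P : Profile n) (m : Fin n) :
    ¬ Rejected P (daState P) m := by
  intro h
  have := congrFun (daRound_daState P) m
  unfold daRound at this
  rw [if_pos h] at this
  omega

theorem proposal_daState_injective {n : ℕ} (P : Profile n) {m m' w : Fin n}
    (h : proposal P (daState P) m = some w) (h' : proposal P (daState P) m' = some w) :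
    m = m' := by
  rcases lt_trichotomy ((P.women w).toList.idxOf m) ((P.women w).toList.idxOf m') with hl | hl | hl
  · exact absurd ⟨w, h', m, h, hl⟩ (not_rejected_daState P m')
  · exact (P.women w).idxOf_inj hl
  · exact absurd ⟨w, h, m', h', hl⟩ (not_rejected_daState P m)

/-- In the final state every man holds an engagement. -/
theorem proposal_daState_isSome {n : ℕ} (P : Profile n) (m : Fin n) :
    (proposal P (daState P) m).isSome := by
  by_contra hcon
  have hinv := daInvariant_iterate P (n * n)
  change DAInvariant P (daState P) at hinv
  have hnone : proposal P (daState P) m = none := by simpa using hcon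
  have hlen : n ≤ daState P m := by
    unfold proposal at hnone
    rw [List.getElem?_eq_none_iff, PrefList.length_eq] at hnone
    exact hnone
  have hall : ∀ w, ∃ m', proposal P (daState P) m' = some w := by
    intro w
    have : (P.men m).toList.idxOf w < (P.men m).toList.length :=
      List.idxOf_lt_length_iff.2 ((P.men m).mem w)
    rw [PrefList.length_eq] at this
    obtain ⟨m', hm', -⟩ := hinv.2 m w (by omega)
    exact ⟨m', hm'⟩
  choose f hf using hall
  have hinj : Function.Injective f := by
    intro a b hab
    have h1 := hf a
    rw [hab, hf b] at h1
    exact (Option.some.inj h1).symm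
  obtain ⟨w, hw⟩ := Finite.surjective_of_injective hinj m
  have h2 := hf w
  rw [hw, hnone] at h2
  cases h2

/-- The woman with whom deferred acceptance matches the man `m`. -/
def daPartner {n : ℕ} (P : Profile n) (m : Fin n) : Fin n :=
  (proposal P (daState P) m).get (proposal_daState_isSome P m)

theorem daPartner_bijective {n : ℕ} (P : Profile n) : Function.Bijective (daPartner P) := by
  apply Function.Injective.bijective_of_finite
  intro a b hab
  refine proposal_daState_injective P (w := daPartner P a) ?_ ?_
  · simp [daPartner]
  · rw [hab]; simp [daPartner]

/-- The matching computed by deferred acceptance: `da P m` is the partner of the man `m` and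
`(da P).symm w` is the partner of the woman `w`. -/
noncomputable def da {n : ℕ} (P : Profile n) : Fin n ≃ Fin n :=
  Equiv.ofBijective (daPartner P) (daPartner_bijective P)

/-! ## One-for-all strategies of an accomplice -/

/-- The profile in which the man `m` reports the list `l` and everybody else is unchanged. -/
def misreport {n : ℕ} (P : Profile n) (m : Fin n) (l : PrefList n) : Profile n where
  men := Function.update P.men m l
  women := P.women

/-- Every woman weakly prefers `μ` to `μ'` with respect to her list in `P`. -/
def WomenWeaklyPrefer {n : ℕ} (P : Profile n) (μ μ' : Fin n ≃ Fin n) : Prop :=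
  ∀ w, (P.women w).WeaklyPrefers (μ.symm w) (μ'.symm w)

/-- Reporting `l` instead of his true list does not worsen the match of `m`. -/
def NoRegret {n : ℕ} (P : Profile n) (m : Fin n) (l : PrefList n) : Prop :=
  (P.men m).WeaklyPrefers (da (misreport P m l) m) (da P m)

/-- `l` is an optimal (no-regret) one-for-all strategy of the accomplice `m`. -/
def IsOptimal {n : ℕ} (P : Profile n) (m : Fin n) (l : PrefList n) : Prop :=
  NoRegret P m l ∧ WomenWeaklyPrefer P (da (misreport P m l)) (da P) ∧
    ∀ l', NoRegret P m l' →
      WomenWeaklyPrefer P (da (misreport P m l)) (da (misreport P m l'))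

open Classical in
/-- The women whom the strategy `l` pushes up: those below the deferred acceptance partner of `m`
in his true list and above that partner in `l`. -/
noncomputable def pushedUp {n : ℕ} (P : Profile n) (m : Fin n) (l : PrefList n) :
    Finset (Fin n) :=
  Finset.univ.filter (fun w => (P.men m).Prefers (da P m) w ∧ l.Prefers w (da P m))

/-- `l` is an optimal one-for-all strategy that pushes up as few women as possible. -/
def IsMinimumOptimal {n : ℕ} (P : Profile n) (m : Fin n) (l : PrefList n) : Prop :=
  IsOptimal P m l ∧ ∀ l', IsOptimal P m l' → (pushedUp P m l).card ≤ (pushedUp P m l').card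

/-- Push the set `X` above `a` in the list `l`: the new list is `(L ∪ X, a, R \ X)`, where `L` and
`R` are the parts of `l` above and below `a`; within each of the two parts the order is that of `l`.
(An element `a` of `X` is ignored.) -/
def PrefList.pushAbove {n : ℕ} (l : PrefList n) (a : Fin n) (X : Finset (Fin n)) :
    PrefList n where
  toList := l.toList.filter (fun w => w ≠ a ∧ (l.Prefers w a ∨ w ∈ X)) ++
    a :: l.toList.filter (fun w => w ≠ a ∧ ¬ (l.Prefers w a ∨ w ∈ X))
  nodup := by
    rw [List.nodup_append]
    refine ⟨l.nodup.filter _, ?_, ?_⟩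
    · rw [List.nodup_cons]
      exact ⟨by simp, l.nodup.filter _⟩
    · intro x hx y hy hxy
      subst hxy
      simp only [List.mem_filter, decide_eq_true_eq, List.mem_cons] at hx hy
      rcases hy with h | h
      · exact hx.2.1 h
      · exact h.2.2 hx.2.2
  mem := by
    intro w
    by_cases h : w = a
    · simp [h]
    · by_cases h' : l.Prefers w a ∨ w ∈ X
      · simp only [List.mem_append, List.mem_filter, decide_eq_true_eq]
        exact Or.inl ⟨l.mem w, h, h'⟩
      · simp only [List.mem_append, List.mem_filter, decide_eq_true_eq, List.mem_cons]
        exact Or.inr (Or.inr ⟨l.mem w, h, h'⟩)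

/-- The strategy of `m` that pushes up the set `X`, i.e. pushes it above the deferred acceptance
partner of `m` in his true list. -/
noncomputable def pushUp {n : ℕ} (P : Profile n) (m : Fin n) (X : Finset (Fin n)) : PrefList n :=
  (P.men m).pushAbove (da P m) X

/-- The matching after `m` pushes up the set `X`. -/
noncomputable def daPushUp {n : ℕ} (P : Profile n) (m : Fin n) (X : Finset (Fin n)) :
    Fin n ≃ Fin n :=
  da (misreport P m (pushUp P m X))

open Classical in
/-- The no-regret set: the women who cause no regret for `m` when pushed up individually. -/
noncomputable def noRegretSet {n : ℕ} (P : Profile n) (m : Fin n) : Finset (Fin n) :=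
  Finset.univ.filter (fun w => NoRegret P m (pushUp P m {w}))

/-- `Y` is a minimum no-regret push up set. -/
def IsMinimumNoRegretPushUpSet {n : ℕ} (P : Profile n) (m : Fin n) (Y : Finset (Fin n)) : Prop :=
  Y ⊆ noRegretSet P m ∧ daPushUp P m Y = daPushUp P m (noRegretSet P m) ∧
    ∀ Z ⊆ noRegretSet P m, daPushUp P m Z = daPushUp P m (noRegretSet P m) → Y.card ≤ Z.card

/-! ## The greedy algorithm, abstractly -/

/-- One successful check of the for-loop: some woman is removed from `Y` and the matching is
still the one obtained by pushing up the whole no-regret set. -/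
def GreedyStep {n : ℕ} (P : Profile n) (m : Fin n) (Y Y' : Finset (Fin n)) : Prop :=
  ∃ w ∈ Y, Y' = Y.erase w ∧ daPushUp P m Y' = daPushUp P m (noRegretSet P m)

/-- `Y` is a possible output of the greedy algorithm, which may go through the women of the current
set in any order: `Y` is reached from the no-regret set by successful removals, and every removal
from `Y` fails. -/
def GreedyReturns {n : ℕ} (P : Profile n) (m : Fin n) (Y : Finset (Fin n)) : Prop :=
  Relation.ReflTransGen (GreedyStep P m) (noRegretSet P m) Y ∧ ∀ Y', ¬ GreedyStep P m Y Y'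

/-! ## A random access machine, as a structured imperative language with running times

A state consists of registers and of two-dimensional tables holding natural numbers. An elementary
operation (reading a constant, a register or a table cell, successor, comparison, Boolean
connective, assignment, branching) costs one unit of time. As the successor is the only arithmetic
operation, no number can exceed the input and program constants by more than the elapsed time. -/

inductive Expr (R T : Type) where
  | const (k : ℕ)
  | reg (r : R)
  | cell (t : T) (i j : Expr R T)
  | succ (e : Expr R T)

inductive BExpr (R T : Type) where
  | lt (a b : Expr R T)
  | eq (a b : Expr R T)
  | not (b : BExpr R T)
  | or (b c : BExpr R T)
  | and (b c : BExpr R T)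

inductive Cmd (R T : Type) where
  | skip
  | set (r : R) (e : Expr R T)
  | store (t : T) (i j e : Expr R T)
  | seq (c d : Cmd R T)
  | ite (b : BExpr R T) (c d : Cmd R T)
  | while (b : BExpr R T) (c : Cmd R T)

structure State (R T : Type) where
  reg : R → ℕ
  tab : T → ℕ → ℕ → ℕ

def Expr.eval {R T : Type} (s : State R T) : Expr R T → ℕ
  | .const k => k
  | .reg r => s.reg r
  | .cell t i j => s.tab t (i.eval s) (j.eval s)
  | .succ e => e.eval s + 1

def Expr.cost {R T : Type} : Expr R T → ℕ
  | .const _ => 1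
  | .reg _ => 1
  | .cell _ i j => i.cost + j.cost + 1
  | .succ e => e.cost + 1

def BExpr.eval {R T : Type} (s : State R T) : BExpr R T → Bool
  | .lt a b => decide (a.eval s < b.eval s)
  | .eq a b => decide (a.eval s = b.eval s)
  | .not b => !b.eval s
  | .or b c => b.eval s || c.eval s
  | .and b c => b.eval s && c.eval s

def BExpr.cost {R T : Type} : BExpr R T → ℕ
  | .lt a b => a.cost + b.cost + 1
  | .eq a b => a.cost + b.cost + 1
  | .not b => b.cost + 1
  | .or b c => b.cost + c.cost + 1
  | .and b c => b.cost + c.cost + 1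

def State.setReg {R T : Type} [DecidableEq R] (s : State R T) (r : R) (v : ℕ) : State R T where
  reg := Function.update s.reg r v
  tab := s.tab

def State.setCell {R T : Type} [DecidableEq T] (s : State R T) (t : T) (i j v : ℕ) :
    State R T where
  reg := s.reg
  tab := Function.update s.tab t
    (Function.update (s.tab t) i (Function.update (s.tab t i) j v))

/-- `Exec c s s' t`: started in the state `s`, the command `c` terminates in the state `s'` after
exactly `t` units of time. -/
inductive Exec {R T : Type} [DecidableEq R] [DecidableEq T] :
    Cmd R T → State R T → State R T → ℕ → Prop where
  | skip (s : State R T) : Exec .skip s s 1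
  | set (s : State R T) (r : R) (e : Expr R T) :
      Exec (.set r e) s (s.setReg r (e.eval s)) (e.cost + 1)
  | store (s : State R T) (t : T) (i j e : Expr R T) :
      Exec (.store t i j e) s (s.setCell t (i.eval s) (j.eval s) (e.eval s))
        (i.cost + j.cost + e.cost + 1)
  | seq {c d : Cmd R T} {s s' s'' : State R T} {t t' : ℕ} :
      Exec c s s' t → Exec d s' s'' t' → Exec (.seq c d) s s'' (t + t')
  | ite_true {b : BExpr R T} {c d : Cmd R T} {s s' : State R T} {t : ℕ} :
      b.eval s = true → Exec c s s' t → Exec (.ite b c d) s s' (b.cost + 1 + t)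
  | ite_false {b : BExpr R T} {c d : Cmd R T} {s s' : State R T} {t : ℕ} :
      b.eval s = false → Exec d s s' t → Exec (.ite b c d) s s' (b.cost + 1 + t)
  | while_true {b : BExpr R T} {c : Cmd R T} {s s' s'' : State R T} {t t' : ℕ} :
      b.eval s = true → Exec c s s' t → Exec (.while b c) s' s'' t' →
        Exec (.while b c) s s'' (b.cost + 1 + t + t')
  | while_false {b : BExpr R T} {c : Cmd R T} {s : State R T} :
      b.eval s = false → Exec (.while b c) s s (b.cost + 1)

infixr:60 " ;; " => Cmd.seq

/-- `for r = 0, …, e - 1 do c`. -/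
def Cmd.for {R T : Type} (r : R) (e : Expr R T) (c : Cmd R T) : Cmd R T :=
  .set r (.const 0) ;; .while (.lt (.reg r) e) (c ;; .set r (.succ (.reg r)))

/-! ## The greedy algorithm as a program -/

/-- Registers. Input: the number `n` of men and the index `acc` of the accomplice. -/
inductive Reg where
  | n | acc | i | j | w | cur | active | h | a | r | pos | y | same
  deriving DecidableEq

/-- Tables. Input: `mp` and `wp`, the preference lists of the men and of the women (row = agent).
Output: `ys`, the indicator function of the current set, and `strat`, the list reported by the
accomplice. Work space: `rank`, the positions of the men in the women's lists; `mrank`, the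
positions of the women in the true list of the accomplice; `next`, the number of proposals made by
each man; `husb`, the current fiance of each woman (`n` if there is none); `nr`, the indicator
function of the no-regret set; `best`, the target matching. One-dimensional tables use row `0`. -/
inductive Tab where
  | mp | wp | ys | strat | rank | mrank | next | husb | nr | best
  deriving DecidableEq

namespace Program

/-- The value of a register. -/
abbrev v (r : Reg) : Expr Reg Tab := .reg r

/-- The entry of a one-dimensional table. -/
abbrev at1 (t : Tab) (e : Expr Reg Tab) : Expr Reg Tab := .cell t (.const 0) e

/-- Assignment to an entry of a one-dimensional table. -/
abbrev put1 (t : Tab) (i e : Expr Reg Tab) : Cmd Reg Tab := .store t (.const 0) i e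

/-- Compute the positions of the men in the women's lists and of the women in the list of the
accomplice; the accomplice initially reports his true list. -/
def prepare : Cmd Reg Tab :=
  .for .i (v .n) (.for .j (v .n) (.store .rank (v .i) (.cell .wp (v .i) (v .j)) (v .j))) ;;
  .for .j (v .n)
    (put1 .mrank (.cell .mp (v .acc) (v .j)) (v .j) ;;
     put1 .strat (v .j) (.cell .mp (v .acc) (v .j)))

/-- Deferred acceptance on the profile in which the accomplice reports `strat`: the men enter one
after the other, and the man who is currently free proposes. -/
def runDA : Cmd Reg Tab :=
  .for .i (v .n) (put1 .next (v .i) (.const 0) ;; put1 .husb (v .i) (v .n)) ;;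
  .for .i (v .n)
    (.set .cur (v .i) ;;
     .set .active (.const 1) ;;
     .while (.eq (v .active) (.const 1))
      (.ite (.eq (v .cur) (v .acc))
        (.set .w (at1 .strat (at1 .next (v .cur))))
        (.set .w (.cell .mp (v .cur) (at1 .next (v .cur)))) ;;
       put1 .next (v .cur) (.succ (at1 .next (v .cur))) ;;
       .set .h (at1 .husb (v .w)) ;;
       .ite (.eq (v .h) (v .n))
        (put1 .husb (v .w) (v .cur) ;; .set .active (.const 0))
        (.ite (.lt (.cell .rank (v .w) (v .cur)) (.cell .rank (v .w) (v .h)))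
          (put1 .husb (v .w) (v .cur) ;; .set .cur (v .h))
          .skip)))

/-- Store the partner of the accomplice in the register `r`. -/
def findPartner (r : Reg) : Cmd Reg Tab :=
  .for .i (v .n) (.ite (.eq (at1 .husb (v .i)) (v .acc)) (.set r (v .i)) .skip)

/-- The woman `w` is truly ranked above `a`, or belongs to the current set. -/
def goesUp : BExpr Reg Tab :=
  .or (.lt (at1 .mrank (v .w)) (at1 .mrank (v .a))) (.eq (at1 .ys (v .w)) (.const 1))

/-- Append the woman `e` to `strat`. -/
def append (e : Expr Reg Tab) : Cmd Reg Tab :=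
  put1 .strat (v .pos) e ;; .set .pos (.succ (v .pos))

/-- Let `strat` be the true list of the accomplice with the set `ys` pushed above `a`. -/
def buildPushUp : Cmd Reg Tab :=
  .set .pos (.const 0) ;;
  .for .i (v .n)
    (.set .w (.cell .mp (v .acc) (v .i)) ;;
     .ite (.and (.not (.eq (v .w) (v .a))) goesUp) (append (v .w)) .skip) ;;
  append (v .a) ;;
  .for .i (v .n)
    (.set .w (.cell .mp (v .acc) (v .i)) ;;
     .ite (.and (.not (.eq (v .w) (v .a))) (.not goesUp)) (append (v .w)) .skip)

/-- Compute the indicator function `nr` of the no-regret set. -/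
def computeNoRegretSet : Cmd Reg Tab :=
  .for .y (v .n) (put1 .ys (v .y) (.const 0)) ;;
  .for .y (v .n)
    (put1 .ys (v .y) (.const 1) ;;
     buildPushUp ;;
     runDA ;;
     findPartner .r ;;
     .ite (.lt (at1 .mrank (v .a)) (at1 .mrank (v .r)))
      (put1 .nr (v .y) (.const 0))
      (put1 .nr (v .y) (.const 1)) ;;
     put1 .ys (v .y) (.const 0))

/-- Let `same` be `1` if the current matching is `best`, and `0` otherwise. -/
def compare : Cmd Reg Tab :=
  .set .same (.const 1) ;;
  .for .i (v .n)
    (.ite (.eq (at1 .husb (v .i)) (at1 .best (v .i))) .skip (.set .same (.const 0)))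

/-- For each `y` in the current set: remove `y`, and check whether the matching changes; if it does
not, restart the loop with the smaller set, otherwise put `y` back and go on. -/
def greedyLoop : Cmd Reg Tab :=
  .set .y (.const 0) ;;
  .while (.lt (v .y) (v .n))
    (.ite (.eq (at1 .ys (v .y)) (.const 1))
      (put1 .ys (v .y) (.const 0) ;;
       buildPushUp ;;
       runDA ;;
       compare ;;
       .ite (.eq (v .same) (.const 1))
        (.set .y (.const 0))
        (put1 .ys (v .y) (.const 1) ;; .set .y (.succ (v .y))))
      (.set .y (.succ (v .y))))

/-- The whole algorithm: compute the true partner `a` of the accomplice, the no-regret set, and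
the matching `best` that results from pushing it up; run the greedy loop; write down the strategy
that pushes up the final set. -/
def main : Cmd Reg Tab :=
  prepare ;;
  runDA ;;
  findPartner .a ;;
  computeNoRegretSet ;;
  .for .y (v .n) (put1 .ys (v .y) (at1 .nr (v .y))) ;;
  buildPushUp ;;
  runDA ;;
  .for .i (v .n) (put1 .best (v .i) (at1 .husb (v .i))) ;;
  greedyLoop ;;
  buildPushUp

end Program

/-- The entry at position `j` of the list of agent `i`, as a number (`0` outside the range). -/
def encodeLists {n : ℕ} (f : Fin n → PrefList n) (i j : ℕ) : ℕ :=
  if hi : i < n then ((f ⟨i, hi⟩).toList[j]?).elim 0 (fun w => (w : ℕ)) else 0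

/-- The initial state for the profile `P` and the accomplice `m`; all work space is `0`. -/
def initState {n : ℕ} (P : Profile n) (m : Fin n) : State Reg Tab where
  reg := fun
    | .n => n
    | .acc => m
    | _ => 0
  tab := fun
    | .mp => encodeLists P.men
    | .wp => encodeLists P.women
    | _ => fun _ _ => 0

/-- The final state `s` exhibits the set `Y` and the strategy `l`. -/
def Outputs {n : ℕ} (s : State Reg Tab) (Y : Finset (Fin n)) (l : PrefList n) : Prop :=
  (∀ w : Fin n, s.tab .ys 0 w = if w ∈ Y then 1 else 0) ∧
    ∀ (k : ℕ) (w : Fin n), l.toList[k]? = some w → s.tab .strat 0 k = w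

end StableMarriage

open StableMarriage

namespace StableMarriage

/-! ## Stable matchings -/

theorem PrefList.prefers_of_not {n : ℕ} (l : PrefList n) {a b : Fin n} (h : ¬ l.Prefers a b)
    (hab : a ≠ b) : l.Prefers b a := by
  unfold PrefList.Prefers at *
  exact lt_of_le_of_ne (not_lt.1 h) fun h' => hab (l.idxOf_inj h').symm

theorem PrefList.weaklyPrefers_iff {n : ℕ} (l : PrefList n) {a b : Fin n} :
    l.WeaklyPrefers a b ↔ ¬ l.Prefers b a := by
  refine ⟨?_, fun h => ?_⟩
  · rintro (h | rfl) h'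
    · exact lt_asymm h h'
    · exact lt_irrefl _ h'
  · by_cases hab : b = a
    · exact Or.inr hab.symm
    · exact Or.inl (l.prefers_of_not h hab)

theorem PrefList.weaklyPrefers_iff_le {n : ℕ} (l : PrefList n) {a b : Fin n} :
    l.WeaklyPrefers a b ↔ l.toList.idxOf a ≤ l.toList.idxOf b := by
  rw [l.weaklyPrefers_iff]; exact not_lt

theorem PrefList.WeaklyPrefers.antisymm {n : ℕ} {l : PrefList n} {a b : Fin n}
    (h : l.WeaklyPrefers a b) (h' : l.WeaklyPrefers b a) : a = b :=
  l.idxOf_inj (le_antisymm (l.weaklyPrefers_iff_le.1 h) (l.weaklyPrefers_iff_le.1 h'))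

theorem WomenWeaklyPrefer.antisymm {n : ℕ} {P : Profile n} {μ ν : Fin n ≃ Fin n}
    (h : WomenWeaklyPrefer P μ ν) (h' : WomenWeaklyPrefer P ν μ) : μ = ν :=
  Equiv.symm_bijective.injective (Equiv.ext fun w => (h w).antisymm (h' w))

/-- No man and woman prefer each other to their partners. -/
def IsStable {n : ℕ} (P : Profile n) (ν : Fin n ≃ Fin n) : Prop :=
  ∀ j w, (P.men j).Prefers w (ν j) → ¬ (P.women w).Prefers j (ν.symm w)

theorem idxOf_da {n : ℕ} (P : Profile n) (j : Fin n) :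
    (P.men j).toList.idxOf (da P j) = daState P j := by
  rw [← proposal_eq_some_iff]
  simp [da, daPartner]

/-- A man has gone past a woman only if she holds a proposal that she likes better; this is
`DAInvariant` in the final state. -/
theorem da_isStable {n : ℕ} (P : Profile n) : IsStable P (da P) := by
  intro j w hw hj
  unfold PrefList.Prefers at hw
  rw [idxOf_da] at hw
  obtain ⟨j', h1, h2⟩ := (daInvariant_iterate P (n * n)).2 j w hw
  change proposal P (daState P) j' = some w at h1
  rw [proposal_eq_some_iff, ← idxOf_da] at h1
  have h3 : w = da P j' := (P.men j').idxOf_inj h1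
  rw [h3, Equiv.symm_apply_apply, ← h3] at hj
  exact lt_asymm hj h2

/-- Deferred acceptance never proceeds beyond a state `K` in which no man is rejected, all
proposals made so far being taken into account. -/
theorem daState_le_of_closed {n : ℕ} (P : Profile n) (K : Fin n → ℕ)
    (hK : ∀ j w, (P.men j).toList.idxOf w = K j → ∀ j', (P.men j').toList.idxOf w ≤ K j' →
      ¬ (P.women w).Prefers j' j) (j : Fin n) : daState P j ≤ K j := by
  suffices h : ∀ t j, (daRound P)^[t] (fun _ => 0) j ≤ K j from h _ j
  intro t
  induction t with
  | zero => exact fun j => Nat.zero_le _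
  | succ t ih =>
    intro j
    rw [Function.iterate_succ_apply']
    generalize (daRound P)^[t] (fun _ => 0) = k at ih
    unfold daRound
    split_ifs with h
    · obtain ⟨w, hw, j', hj', hp⟩ := h
      rw [proposal_eq_some_iff] at hw hj'
      refine lt_of_le_of_ne (ih j) fun hk => ?_
      exact hK j w (hw.trans hk) j' (hj'.le.trans (ih j')) hp
    · exact ih j

/-- The positions of the partners in a stable matching form a closed state in the sense of
`daState_le_of_closed`: a rejection there would be a blocking pair. -/
theorem da_manOptimal {n : ℕ} (P : Profile n) {ν : Fin n ≃ Fin n} (hν : IsStable P ν)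
    (j : Fin n) : (P.men j).WeaklyPrefers (da P j) (ν j) := by
  rw [PrefList.weaklyPrefers_iff_le, idxOf_da]
  refine daState_le_of_closed P (fun j => (P.men j).toList.idxOf (ν j)) ?_ j
  intro j w hw j' hj' hp
  have hwj := (P.men j).idxOf_inj hw
  rcases hj'.lt_or_eq with h | h
  · refine hν j' w h ?_
    rwa [hwj, Equiv.symm_apply_apply, ← hwj]
  · have h' := (P.men j').idxOf_inj h
    rw [ν.injective (h'.symm.trans hwj)] at hp
    exact lt_irrefl _ hp

/-- If a woman preferred her deferred acceptance partner to her partner in `ν`, those two would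
block `ν`, because he does at least as well with her as in `ν`. -/
theorem da_womanPessimal {n : ℕ} (P : Profile n) {ν : Fin n ≃ Fin n} (hν : IsStable P ν) :
    WomenWeaklyPrefer P ν (da P) := by
  intro w
  rw [PrefList.weaklyPrefers_iff]
  intro h
  have h1 := da_manOptimal P hν ((da P).symm w)
  rw [Equiv.apply_symm_apply] at h1
  rcases h1 with h1 | h1
  · exact hν _ _ h1 h
  · rw [h1, Equiv.symm_apply_apply, ← h1] at h
    exact lt_irrefl _ h

/-- If every woman picks the better one of her partners in two stable matchings, the result is a
stable matching. -/
theorem IsStable.exists_join {n : ℕ} {P : Profile n} {μ ν : Fin n ≃ Fin n} (hμ : IsStable P μ)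
    (hν : IsStable P ν) : ∃ κ : Fin n ≃ Fin n, IsStable P κ ∧ WomenWeaklyPrefer P κ μ ∧
      WomenWeaklyPrefer P κ ν ∧ ∀ w, κ.symm w = μ.symm w ∨ κ.symm w = ν.symm w := by
  classical
  let f : Fin n → Fin n := fun w =>
    if (P.women w).Prefers (μ.symm w) (ν.symm w) then μ.symm w else ν.symm w
  have hfor : ∀ w, f w = μ.symm w ∨ f w = ν.symm w := by
    intro w; dsimp only [f]; split_ifs <;> simp
  have hfμ : ∀ w, (P.women w).WeaklyPrefers (f w) (μ.symm w) := by
    intro w; dsimp only [f]; split_ifs with h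
    · exact Or.inr rfl
    · exact (P.women w).weaklyPrefers_iff.2 h
  have hfν : ∀ w, (P.women w).WeaklyPrefers (f w) (ν.symm w) := by
    intro w; dsimp only [f]; split_ifs with h
    · exact Or.inl h
    · exact Or.inr rfl
  -- If one man were picked by `w` out of `μ` and by another `w'` out of `ν`, the woman he prefers
  -- would block, together with him, the matching in which he has the other one.
  have hinj : ∀ w w', f w = μ.symm w → f w' = ν.symm w' → f w = f w' → w = w' := by
    intro w w' h1 h2 h3
    by_contra hne
    have e1 : μ (f w) = w := by rw [h1, Equiv.apply_symm_apply]
    have e2 : ν (f w) = w' := by rw [h3, h2, Equiv.apply_symm_apply]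
    by_cases hp : (P.men (f w)).Prefers w w'
    · rcases hfν w with h | h
      · exact hν (f w) w (by rwa [e2]) h
      · rw [h, Equiv.apply_symm_apply] at e2
        exact hne e2
    · have hp' := (P.men (f w)).prefers_of_not hp hne
      rcases hfμ w' with h | h
      · exact hμ (f w) w' (by rwa [e1]) (by rwa [h3])
      · rw [h3, h, Equiv.apply_symm_apply] at e1
        exact hne e1.symm
  have hf : Function.Injective f := by
    intro w w' h
    rcases hfor w with h1 | h1 <;> rcases hfor w' with h2 | h2
    · exact μ.symm.injective (by rw [← h1, ← h2, h])
    · exact hinj w w' h1 h2 h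
    · exact (hinj w' w h2 h1 h.symm).symm
    · exact ν.symm.injective (by rw [← h1, ← h2, h])
  refine ⟨(Equiv.ofBijective f (Function.Injective.bijective_of_finite hf)).symm, ?_, ?_⟩
  · intro j w hj hw
    rw [Equiv.symm_symm, Equiv.ofBijective_apply] at hw
    obtain ⟨w', rfl⟩ := (Function.Injective.bijective_of_finite hf).2 j
    have e : (Equiv.ofBijective f (Function.Injective.bijective_of_finite hf)).symm (f w') = w' := by
      rw [Equiv.symm_apply_eq, Equiv.ofBijective_apply]
    rw [e] at hj
    have hlt : ∀ a, (P.women w).WeaklyPrefers (f w) a → (P.women w).Prefers (f w') a := by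
      intro a ha
      rw [PrefList.weaklyPrefers_iff_le] at ha
      exact lt_of_lt_of_le hw ha
    rcases hfor w' with h | h
    · refine hμ (f w') w ?_ (hlt _ (hfμ w))
      rwa [h, Equiv.apply_symm_apply, ← h]
    · refine hν (f w') w ?_ (hlt _ (hfν w))
      rwa [h, Equiv.apply_symm_apply, ← h]
  · refine ⟨fun w => ?_, fun w => ?_, fun w => ?_⟩
    · simpa using hfμ w
    · simpa using hfν w
    · simpa using hfor w

/-! ## Strategyproofness -/

/-- The blocking lemma: if some man prefers `ν` to the outcome of deferred acceptance, then `ν` is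
blocked by a pair whose man is not one of those. -/
theorem not_prefers_da_of_blocking {n : ℕ} (P : Profile n) (ν : Fin n ≃ Fin n)
    (hν : ∀ j w, (P.men j).Prefers w (ν j) → (P.women w).Prefers j (ν.symm w) →
      (P.men j).Prefers (ν j) (da P j)) (i : Fin n) : ¬ (P.men i).Prefers (ν i) (da P i) := by
  classical
  intro hi
  set M : Set (Fin n) := {j | (P.men j).Prefers (ν j) (da P j)} with hM
  -- The deferred acceptance partner `b` of `ν j` lies in `M` too; otherwise `b` and `ν j` would
  -- block `ν` with a man outside `M`. Thus both matchings assign the same set of women to `M`.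
  have hmaps : Set.MapsTo (ν.trans (da P).symm : Equiv.Perm (Fin n)) M M := by
    intro j hj
    by_contra hcon
    set b := (ν.trans (da P).symm : Equiv.Perm (Fin n)) j with hb
    have hbw : da P b = ν j := by rw [hb]; simp
    have hne : j ≠ b := fun h => hcon (h ▸ hj)
    have h1 := da_isStable P j (ν j) hj
    rw [← hbw, Equiv.symm_apply_apply, hbw] at h1
    have h2 := (P.women (ν j)).prefers_of_not h1 hne
    have h3 : (P.men b).Prefers (ν j) (ν b) := by
      rw [← hbw]
      refine (P.men b).prefers_of_not hcon fun h => hne (ν.injective ?_)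
      rw [h, hbw]
    exact hcon (hν b (ν j) h3 (by simpa using h2))
  have hsurj : ∀ i ∈ M, ∃ j ∈ M, ν j = da P i := by
    intro i hi
    refine ⟨_, Equiv.Perm.perm_symm_mapsTo_of_mapsTo _ hmaps hi, ?_⟩
    simp
  let k : ℕ → Fin n → ℕ := fun t => (daRound P)^[t] (fun _ => 0)
  have hsucc : ∀ t, k (t + 1) = daRound P (k t) := fun t => Function.iterate_succ_apply' _ _ _
  have hmono : ∀ j, Monotone (fun t => k t j) := fun j => monotone_nat_of_le_succ fun t => by
    rw [hsucc]; exact le_daRound P _ _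
  -- Take the first round `T` after which all men of `M` have reached their final proposals. It is
  -- not `0`, since each of them is rejected at least once. One of them, `i`, arrives only in the
  -- last of these rounds.
  have hex : ∃ T, ∀ j ∈ M, k T j = daState P j := ⟨n * n, fun j _ => rfl⟩
  have hle := Nat.find_min' hex (fun j _ => rfl : ∀ j ∈ M, k (n * n) j = daState P j)
  have hspec := Nat.find_spec hex
  have hmin := fun t => Nat.find_min (H := hex) (m := t)
  generalize Nat.find hex = T at hle hspec hmin
  obtain _ | t := T
  · have h1 := hspec i hi
    have h2 : (P.men i).toList.idxOf (ν i) < (P.men i).toList.idxOf (da P i) := hi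
    rw [idxOf_da, ← h1] at h2
    exact absurd h2 (Nat.not_lt_zero _)
  · have h1 := hmin t (Nat.lt_succ_self t)
    push Not at h1
    obtain ⟨i, hiM, hit⟩ := h1
    obtain ⟨j, hjM, hji⟩ := hsurj i hiM
    have hjr : (P.men j).toList.idxOf (da P i) < k (t + 1) j := by
      rw [hspec j hjM, ← idxOf_da, ← hji]; exact hjM
    have hprop : ∃ b, proposal P (k t) b = some (da P i) ∧ (P.women (da P i)).Prefers b j := by
      by_cases h : (P.men j).toList.idxOf (da P i) < k t j
      · exact (daInvariant_iterate P t).2 j _ h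
      · rw [hsucc] at hjr
        unfold daRound at hjr
        split_ifs at hjr with hr
        · obtain ⟨w, hw, b, hb, hp⟩ := hr
          rw [proposal_eq_some_iff] at hw
          have : w = da P i := (P.men j).idxOf_inj (by omega)
          subst this
          exact ⟨b, hb, hp⟩
        · exact absurd hjr h
    -- Just before that round the woman `da P i` holds a favourite proposal by some `b`. She prefers
    -- him to `j`, her partner in `ν`, and he is not rejected in this round.
    obtain ⟨b₁, hb₁, hb₁j⟩ := hprop
    obtain ⟨b, hb, hbmin⟩ := Finset.exists_min_image
      (Finset.univ.filter (fun b => proposal P (k t) b = some (da P i)))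
      (fun b => (P.women (da P i)).toList.idxOf b) ⟨b₁, by simp [hb₁]⟩
    simp only [Finset.mem_filter, Finset.mem_univ, true_and] at hb hbmin
    have hbj : (P.women (da P i)).Prefers b j := lt_of_le_of_lt (hbmin b₁ hb₁) hb₁j
    have hnr : ¬ Rejected P (k t) b := by
      rintro ⟨w, hw, b', hb', hp⟩
      rw [hb] at hw
      cases hw
      exact absurd (hbmin b' hb') (not_le.2 hp)
    have hstay : k (t + 1) b = k t b := by
      rw [hsucc]; unfold daRound; rw [if_neg hnr]
    rw [proposal_eq_some_iff] at hb
    have hbi : b ≠ i := by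
      rintro rfl
      rw [idxOf_da] at hb
      exact hit hb.symm
    -- A man of `M` would now be at his final proposal, so `b` would be matched with `da P i` and
    -- equal `i`, who had not arrived yet. Hence `b` and `da P i` block `ν` although `b` is outside
    -- `M`.
    have hbM : b ∉ M := by
      intro h
      have h2 := hspec b h
      rw [hstay, ← hb, ← idxOf_da] at h2
      exact hbi ((da P).injective ((P.men b).idxOf_inj h2)).symm
    refine hbM (hν b (da P i) ?_ ?_)
    · have h2 : (P.men b).toList.idxOf (da P i) ≤ (P.men b).toList.idxOf (da P b) := by
        rw [hb, idxOf_da]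
        exact hmono b (by omega : t ≤ n * n)
      have h3 : (P.men b).toList.idxOf (da P b) ≤ (P.men b).toList.idxOf (ν b) := not_lt.1 hbM
      refine lt_of_le_of_ne (h2.trans h3) fun h => ?_
      have h4 := (P.men b).idxOf_inj h
      rw [← hji] at h4
      exact hbM (ν.injective h4 ▸ hjM)
    · rw [← hji, Equiv.symm_apply_apply, hji]
      exact hbj

theorem misreport_misreport {n : ℕ} (P : Profile n) (m : Fin n) (l l' : PrefList n) :
    misreport (misreport P m l) m l' = misreport P m l' := by
  simp [misreport]

theorem misreport_self {n : ℕ} (P : Profile n) (m : Fin n) : misreport P m (P.men m) = P := by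
  simp [misreport]

/-- Deferred acceptance is strategyproof for the men. -/
theorem da_strategyproof {n : ℕ} (P : Profile n) (m : Fin n) (l : PrefList n) :
    ¬ (P.men m).Prefers (da (misreport P m l) m) (da P m) := by
  intro h
  refine not_prefers_da_of_blocking P (da (misreport P m l)) ?_ m h
  -- With respect to the true lists, only pairs containing the liar can block his manipulated
  -- outcome, and he is assumed to gain.
  intro j w hj hw
  by_cases hjm : j = m
  · rwa [hjm]
  · refine absurd hw (da_isStable (misreport P m l) j w ?_)
    simpa [misreport, Function.update_of_ne hjm] using hj

/-- No report yields a woman whom the list `l` ranks above the outcome of `l`. -/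
theorem da_misreport_strategyproof {n : ℕ} (P : Profile n) (m : Fin n) (l l' : PrefList n) :
    ¬ l.Prefers (da (misreport P m l') m) (da (misreport P m l) m) := by
  have h := da_strategyproof (misreport P m l) m l'
  rw [misreport_misreport] at h
  simpa [misreport] using h

/-! ## Reports that do not change the match of the accomplice -/

/-- The outcome under `l'` is stable also when `m` reports `l`: his partner is the same, and every
woman whom `l` ranks above her is above her in `l'` as well. Woman-pessimality under `l` concludes.
-/
theorem da_misreport_womanMonotone {n : ℕ} {P : Profile n} {m : Fin n} {l l' : PrefList n}
    (h : da (misreport P m l') m = da (misreport P m l) m)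
    (hl : ∀ w, l.Prefers w (da (misreport P m l) m) → l'.Prefers w (da (misreport P m l) m)) :
    WomenWeaklyPrefer P (da (misreport P m l')) (da (misreport P m l)) := by
  refine da_womanPessimal (misreport P m l) ?_
  intro j w hj hw
  refine da_isStable (misreport P m l') j w ?_ hw
  by_cases hjm : j = m
  · subst hjm
    simp only [misreport, Function.update_self] at hj ⊢
    simp only [misreport] at h hl
    rw [h] at hj ⊢
    exact hl w hj
  · simpa [misreport, Function.update_of_ne hjm] using hj

theorem noRegret_iff {n : ℕ} {P : Profile n} {m : Fin n} {l : PrefList n} :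
    NoRegret P m l ↔ da (misreport P m l) m = da P m :=
  ⟨fun h => h.resolve_left (da_strategyproof P m l), Or.inr⟩

/-! ### Push-up lists, options of the accomplice, and the no-regret set. -/

theorem PrefList.pushAbove_prefers_iff {n : ℕ} (l : PrefList n) (a : Fin n) (X : Finset (Fin n))
    (w : Fin n) : (l.pushAbove a X).Prefers w a ↔ w ≠ a ∧ (l.Prefers w a ∨ w ∈ X) := by
  have ha : a ∉ l.toList.filter (fun w => w ≠ a ∧ (l.Prefers w a ∨ w ∈ X)) := by simp
  unfold PrefList.Prefers
  simp only [PrefList.pushAbove]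
  rw [List.idxOf_append_of_notMem ha, List.idxOf_cons_self, Nat.add_zero]
  by_cases hw : w ∈ l.toList.filter (fun w => w ≠ a ∧ (l.Prefers w a ∨ w ∈ X))
  · rw [List.idxOf_append_of_mem hw]
    exact iff_of_true (List.idxOf_lt_length_iff.2 hw) (of_decide_eq_true (List.mem_filter.1 hw).2)
  · rw [List.idxOf_append_of_notMem hw]
    exact iff_of_false (by omega) fun h => hw (List.mem_filter.2 ⟨l.mem w, decide_eq_true h⟩)

theorem pushUp_prefers_iff {n : ℕ} (P : Profile n) (m : Fin n) (X : Finset (Fin n)) (w : Fin n) :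
    (pushUp P m X).Prefers w (da P m) ↔
      w ≠ da P m ∧ ((P.men m).Prefers w (da P m) ∨ w ∈ X) :=
  PrefList.pushAbove_prefers_iff _ _ _ _

/-- The partners that the accomplice can obtain by some report. -/
def IsOption {n : ℕ} (P : Profile n) (m w : Fin n) : Prop :=
  ∃ l, da (misreport P m l) m = w

/-- The outcome under `l` is itself an option, and strategyproofness with `l` taken as the true list
shows that no option beats it in `l`. -/
theorem da_misreport_eq_of_isOption {n : ℕ} {P : Profile n} {m a : Fin n} {l : PrefList n}
    (ha : IsOption P m a) (h : ∀ w, IsOption P m w → ¬ l.Prefers w a) :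
    da (misreport P m l) m = a := by
  obtain ⟨l', rfl⟩ := ha
  by_contra hne
  exact h _ ⟨l, rfl⟩
    (l.prefers_of_not (da_misreport_strategyproof P m l l') (fun h => hne h.symm))

theorem isOption_da {n : ℕ} (P : Profile n) (m : Fin n) : IsOption P m (da P m) :=
  ⟨P.men m, by rw [misreport_self]⟩

theorem mem_noRegretSet {n : ℕ} {P : Profile n} {m w : Fin n} :
    w ∈ noRegretSet P m ↔ NoRegret P m (pushUp P m {w}) := by
  classical
  simp [noRegretSet]

/-- If `w` is an option other than `da P m`, pushing her up and still receiving `da P m` would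
contradict strategyproofness. If she is not an option, the best option in the new list is unchanged.
-/
theorem mem_noRegretSet_iff {n : ℕ} {P : Profile n} {m w : Fin n} :
    w ∈ noRegretSet P m ↔ w = da P m ∨ ¬ IsOption P m w := by
  rw [mem_noRegretSet, noRegret_iff]
  constructor
  · intro h
    by_contra! hcon
    obtain ⟨hne, l, hl⟩ := hcon
    have h1 := da_misreport_strategyproof P m (pushUp P m {w}) l
    rw [h, hl] at h1
    exact h1 ((pushUp_prefers_iff P m {w} w).2 ⟨hne, by simp⟩)
  · intro h
    refine da_misreport_eq_of_isOption (isOption_da P m) ?_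
    rintro w' ⟨l, hl⟩ hp
    rw [pushUp_prefers_iff] at hp
    obtain ⟨hne, hp | hp⟩ := hp
    · rw [← hl] at hp
      exact da_strategyproof P m l hp
    · rw [Finset.mem_singleton] at hp
      subst hp
      exact h.elim hne fun h => h ⟨l, hl⟩

theorem daPushUp_apply {n : ℕ} {P : Profile n} {m : Fin n} {X : Finset (Fin n)}
    (hX : X ⊆ noRegretSet P m) : daPushUp P m X m = da P m := by
  refine da_misreport_eq_of_isOption (isOption_da P m) ?_
  rintro w hw hp
  rw [pushUp_prefers_iff] at hp
  obtain ⟨hne, hp | hp⟩ := hp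
  · obtain ⟨l, rfl⟩ := hw
    exact da_strategyproof P m l hp
  · exact (mem_noRegretSet_iff.1 (hX hp)).elim hne fun h => h hw

theorem daPushUp_symm_apply {n : ℕ} {P : Profile n} {m : Fin n} {X : Finset (Fin n)}
    (hX : X ⊆ noRegretSet P m) : (daPushUp P m X).symm (da P m) = m := by
  rw [Equiv.symm_apply_eq, daPushUp_apply hX]

theorem daPushUp_mono {n : ℕ} {P : Profile n} {m : Fin n} {X Y : Finset (Fin n)} (hXY : X ⊆ Y)
    (hY : Y ⊆ noRegretSet P m) : WomenWeaklyPrefer P (daPushUp P m Y) (daPushUp P m X) := by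
  have hX := daPushUp_apply (hXY.trans hY)
  refine da_misreport_womanMonotone ((daPushUp_apply hY).trans hX.symm) ?_
  change ∀ w, (pushUp P m X).Prefers w (daPushUp P m X m) →
    (pushUp P m Y).Prefers w (daPushUp P m X m)
  rw [hX]
  intro w hw
  rw [pushUp_prefers_iff] at hw ⊢
  exact ⟨hw.1, hw.2.imp_right (@hXY w)⟩

/-! ### Reduction of arbitrary no-regret reports to push-up sets. -/

theorem mem_pushedUp_iff {n : ℕ} {P : Profile n} {m : Fin n} {l : PrefList n} {w : Fin n} :
    w ∈ pushedUp P m l ↔ (P.men m).Prefers (da P m) w ∧ l.Prefers w (da P m) := by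
  classical
  simp [pushedUp]

theorem pushedUp_subset_noRegretSet {n : ℕ} {P : Profile n} {m : Fin n} {l : PrefList n}
    (hl : NoRegret P m l) : pushedUp P m l ⊆ noRegretSet P m := by
  intro w hw
  rw [mem_noRegretSet_iff]
  right
  rintro ⟨l', hl'⟩
  refine da_misreport_strategyproof P m l l' ?_
  rw [hl', noRegret_iff.1 hl]
  exact (mem_pushedUp_iff.1 hw).2

/-- The push-up list keeps all truly better women above the partner and adds those whom `l` puts
there, so its upper part contains that of `l`. -/
theorem daPushUp_pushedUp_le {n : ℕ} {P : Profile n} {m : Fin n} {l : PrefList n}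
    (hl : NoRegret P m l) :
    WomenWeaklyPrefer P (daPushUp P m (pushedUp P m l)) (da (misreport P m l)) := by
  have h := daPushUp_apply (pushedUp_subset_noRegretSet hl)
  have hl' := noRegret_iff.1 hl
  refine da_misreport_womanMonotone (h.trans hl'.symm) ?_
  rw [hl']
  intro w hw
  rw [pushUp_prefers_iff]
  have hne : w ≠ da P m := by rintro rfl; exact lt_irrefl _ hw
  refine ⟨hne, ?_⟩
  by_cases hp : (P.men m).Prefers w (da P m)
  · exact Or.inl hp
  · exact Or.inr (mem_pushedUp_iff.2 ⟨(P.men m).prefers_of_not hp hne, hw⟩)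

theorem WomenWeaklyPrefer.trans {n : ℕ} {P : Profile n} {μ ν κ : Fin n ≃ Fin n}
    (h : WomenWeaklyPrefer P μ ν) (h' : WomenWeaklyPrefer P ν κ) : WomenWeaklyPrefer P μ κ := by
  intro w
  have h1 := h w
  have h2 := h' w
  rw [PrefList.weaklyPrefers_iff_le] at *
  exact h1.trans h2

theorem noRegret_pushUp {n : ℕ} {P : Profile n} {m : Fin n} {X : Finset (Fin n)}
    (hX : X ⊆ noRegretSet P m) : NoRegret P m (pushUp P m X) :=
  noRegret_iff.2 (daPushUp_apply hX)

theorem noRegretSet_pushUp_le {n : ℕ} {P : Profile n} {m : Fin n} {l : PrefList n}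
    (hl : NoRegret P m l) :
    WomenWeaklyPrefer P (daPushUp P m (noRegretSet P m)) (da (misreport P m l)) :=
  (daPushUp_mono (pushedUp_subset_noRegretSet hl) subset_rfl).trans (daPushUp_pushedUp_le hl)

theorem noRegret_men {n : ℕ} (P : Profile n) (m : Fin n) : NoRegret P m (P.men m) :=
  noRegret_iff.2 (by rw [misreport_self])

theorem isOptimal_iff {n : ℕ} {P : Profile n} {m : Fin n} {l : PrefList n} (hl : NoRegret P m l) :
    IsOptimal P m l ↔ da (misreport P m l) = daPushUp P m (noRegretSet P m) := by
  constructor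
  · exact fun h => (h.2.2 _ (noRegret_pushUp subset_rfl)).antisymm (noRegretSet_pushUp_le hl)
  · intro h
    refine ⟨hl, ?_, fun l' hl' => ?_⟩
    · have := noRegretSet_pushUp_le (noRegret_men P m)
      rwa [misreport_self, ← h] at this
    · rw [h]
      exact noRegretSet_pushUp_le hl'

theorem pushedUp_pushUp_subset {n : ℕ} {P : Profile n} {m : Fin n} {X : Finset (Fin n)} :
    pushedUp P m (pushUp P m X) ⊆ X := by
  intro w hw
  rw [mem_pushedUp_iff, pushUp_prefers_iff] at hw
  exact hw.2.2.resolve_left (lt_asymm hw.1)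

/-- A minimum no-regret push up set yields a minimum optimal strategy. -/
theorem IsMinimumNoRegretPushUpSet.isMinimumOptimal {n : ℕ} {P : Profile n} {m : Fin n}
    {Y : Finset (Fin n)} (h : IsMinimumNoRegretPushUpSet P m Y) :
    IsMinimumOptimal P m (pushUp P m Y) := by
  obtain ⟨hY, hYeq, hmin⟩ := h
  refine ⟨(isOptimal_iff (noRegret_pushUp hY)).2 hYeq, fun l hl => ?_⟩
  refine (Finset.card_le_card pushedUp_pushUp_subset).trans
    (hmin _ (pushedUp_subset_noRegretSet hl.1) ?_)
  -- The matching of the pushed-up set lies between that of `l` and that of the whole no-regret set,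
  -- which coincide by optimality.
  refine WomenWeaklyPrefer.antisymm (P := P) ?_
    (daPushUp_mono (pushedUp_subset_noRegretSet hl.1) subset_rfl)
  rw [← (isOptimal_iff hl.1).1 hl]
  exact daPushUp_pushedUp_le hl.1

/-! ## The matchings obtained by pushing up sets of women -/

/-- The women whom the accomplice ranks above his partner in a push-up list prefer their partners
in the push-up matching to him. -/
theorem prefers_daPushUp_symm {n : ℕ} {P : Profile n} {m : Fin n} {X : Finset (Fin n)}
    (hX : X ⊆ noRegretSet P m) {w : Fin n} (hw : w ≠ da P m)
    (hwX : (P.men m).Prefers w (da P m) ∨ w ∈ X) :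
    (P.women w).Prefers ((daPushUp P m X).symm w) m := by
  have h := da_isStable (misreport P m (pushUp P m X)) m w
  have hX' := daPushUp_apply hX
  unfold daPushUp at hX'
  rw [hX'] at h
  simp only [misreport, Function.update_self] at h
  refine (P.women w).prefers_of_not (h ((pushUp_prefers_iff P m X w).2 ⟨hw, hwX⟩)) ?_
  exact fun h' => hw (((Equiv.eq_symm_apply _).1 h').symm.trans (daPushUp_apply hX))

/-- The push-up matchings are stable with respect to the true preferences. -/
theorem daPushUp_isStable {n : ℕ} {P : Profile n} {m : Fin n} {X : Finset (Fin n)}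
    (hX : X ⊆ noRegretSet P m) : IsStable P (daPushUp P m X) := by
  intro j w hj hw
  by_cases hjm : j = m
  · subst hjm
    rw [daPushUp_apply hX] at hj
    exact lt_asymm hw (prefers_daPushUp_symm hX (by rintro rfl; exact lt_irrefl _ hj) (Or.inl hj))
  · refine da_isStable (misreport P m (pushUp P m X)) j w ?_ hw
    simp only [misreport, Function.update_of_ne hjm]
    exact hj

/-- Among the stable matchings that leave the accomplice with his partner and in which the women
of `X` are not worse off than with him, the women like the push-up matching least. -/
theorem womenWeaklyPrefer_daPushUp {n : ℕ} {P : Profile n} {m : Fin n} {X : Finset (Fin n)}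
    (hX : X ⊆ noRegretSet P m) {ν : Fin n ≃ Fin n} (hν : IsStable P ν) (hm : ν m = da P m)
    (hνX : ∀ w ∈ X, w ≠ da P m → ¬ (P.women w).Prefers m (ν.symm w)) :
    WomenWeaklyPrefer P ν (daPushUp P m X) := by
  refine da_womanPessimal (misreport P m (pushUp P m X)) ?_
  intro j w hj hw
  by_cases hjm : j = m
  · subst hjm
    simp only [misreport, Function.update_self] at hj
    rw [hm, pushUp_prefers_iff] at hj
    obtain ⟨hne, hj | hj⟩ := hj
    · exact hν j w (by rwa [hm]) hw
    · exact hνX w hj hne hw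
  · refine hν j w ?_ hw
    simpa [misreport, Function.update_of_ne hjm] using hj

/-- A woman who likes the joint push-up matching more than the accomplice already does so in one
of the two separate ones. -/
theorem daPushUp_union_symm {n : ℕ} {P : Profile n} {m : Fin n} {X Y : Finset (Fin n)}
    (hX : X ⊆ noRegretSet P m) (hY : Y ⊆ noRegretSet P m) (w : Fin n) :
    (daPushUp P m (X ∪ Y)).symm w = (daPushUp P m X).symm w ∨
      (daPushUp P m (X ∪ Y)).symm w = (daPushUp P m Y).symm w := by
  have hXY := Finset.union_subset hX hY
  obtain ⟨κ, hκ, hκX, hκY, hor⟩ := (daPushUp_isStable hX).exists_join (daPushUp_isStable hY)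
  have hκm : κ m = da P m := by
    have := hor (da P m)
    rw [daPushUp_symm_apply hX, daPushUp_symm_apply hY, or_self, Equiv.symm_apply_eq] at this
    exact this.symm
  -- The join `κ` competes in the pessimality statement for the union: a woman of `X` or `Y` already
  -- prefers her partner in the corresponding matching to `m`.
  have hle : WomenWeaklyPrefer P κ (daPushUp P m (X ∪ Y)) := by
    refine womenWeaklyPrefer_daPushUp hXY hκ hκm fun w hw hne h => ?_
    have key : ∀ Z ⊆ noRegretSet P m, WomenWeaklyPrefer P κ (daPushUp P m Z) → w ∈ Z → False := by
      intro Z hZ hκZ hwZ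
      have h1 := prefers_daPushUp_symm hZ hne (Or.inr hwZ)
      have h2 := hκZ w
      rw [PrefList.weaklyPrefers_iff_le] at h2
      exact lt_asymm h (lt_of_le_of_lt h2 h1)
    exact (Finset.mem_union.1 hw).elim (key X hX hκX) (key Y hY hκY)
  have heq : (daPushUp P m (X ∪ Y)).symm w = κ.symm w := by
    refine PrefList.WeaklyPrefers.antisymm ?_ (hle w)
    rcases hor w with h | h <;> rw [h]
    · exact daPushUp_mono Finset.subset_union_left hXY w
    · exact daPushUp_mono Finset.subset_union_right hXY w
  rw [heq]
  exact hor w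

/-- Joins are taken woman by woman, so adding elements one at a time traces each woman's partner
back to a single element, or to the empty set. -/
theorem daPushUp_symm_eq_empty_or {n : ℕ} {P : Profile n} {m : Fin n} {X : Finset (Fin n)}
    (hX : X ⊆ noRegretSet P m) (w : Fin n) :
    (daPushUp P m X).symm w = (daPushUp P m ∅).symm w ∨
      ∃ x ∈ X, (daPushUp P m X).symm w = (daPushUp P m {x}).symm w := by
  classical
  induction X using Finset.induction_on with
  | empty => exact Or.inl rfl
  | insert x X _ ih =>
    have hX' := (Finset.subset_insert x X).trans hX
    have hx := (Finset.singleton_subset_iff.2 (Finset.mem_insert_self x X)).trans hX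
    rw [Finset.insert_eq]
    rcases daPushUp_union_symm hx hX' w with h | h
    · exact Or.inr ⟨x, Finset.mem_union_left _ (Finset.mem_singleton_self x), h⟩
    · rw [h]
      refine (ih hX').imp_right ?_
      rintro ⟨y, hy, h⟩
      exact ⟨y, Finset.mem_union_right _ hy, h⟩

/-- A removable woman: pushing up `Y` without `y` is already enough if the other women of `Y`
lead to a matching in which `y` prefers her partner to the accomplice. -/
theorem daPushUp_erase_eq {n : ℕ} {P : Profile n} {m : Fin n} {Y : Finset (Fin n)}
    (hY : Y ⊆ noRegretSet P m) {y : Fin n} {Z : Finset (Fin n)} (hZ : Z ⊆ Y.erase y)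
    (h : y ≠ da P m → (P.women y).Prefers ((daPushUp P m Z).symm y) m) :
    daPushUp P m (Y.erase y) = daPushUp P m Y := by
  have hE := (Finset.erase_subset y Y).trans hY
  refine WomenWeaklyPrefer.antisymm (P := P) ?_ (daPushUp_mono (Finset.erase_subset y Y) hY)
  refine womenWeaklyPrefer_daPushUp hY (daPushUp_isStable hE) (daPushUp_apply hE) ?_
  intro w hw hne hp
  by_cases hwy : w = y
  · subst hwy
    have h1 := h hne
    have h2 := daPushUp_mono hZ hE w
    rw [PrefList.weaklyPrefers_iff_le] at h2
    exact lt_asymm hp (lt_of_le_of_lt h2 h1)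
  · exact lt_asymm hp (prefers_daPushUp_symm hE hne (Or.inr (Finset.mem_erase.2 ⟨hwy, hw⟩)))

/-- A set from which no single woman can be removed is smallest among all sets with the same
push-up matching. -/
theorem card_le_card_of_daPushUp_eq {n : ℕ} {P : Profile n} {m : Fin n} {Y Z : Finset (Fin n)}
    (hY : Y ⊆ noRegretSet P m) (hZ : Z ⊆ noRegretSet P m)
    (hYZ : daPushUp P m Y = daPushUp P m Z)
    (hmin : ∀ y ∈ Y, daPushUp P m (Y.erase y) ≠ daPushUp P m Y) : Y.card ≤ Z.card := by
  classical
  -- Pushing up `da P m` has no effect, so an irredundant set does not contain her.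
  have hne : ∀ y ∈ Y, y ≠ da P m := fun y hy h =>
    hmin y hy (daPushUp_erase_eq hY (Finset.empty_subset _) fun h' => absurd h h')
  have key : ∀ X ⊆ noRegretSet P m, daPushUp P m X = daPushUp P m Y → ∀ y,
      (P.women y).Prefers ((daPushUp P m Y).symm y) m →
      (P.women y).Prefers ((daPushUp P m ∅).symm y) m ∨
      ∃ x ∈ X, (P.women y).Prefers ((daPushUp P m {x}).symm y) m := by
    intro X hX hXY y hy
    rw [← hXY] at hy
    rcases daPushUp_symm_eq_empty_or hX y with h | ⟨x, hx, h⟩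
    · exact Or.inl (h ▸ hy)
    · exact Or.inr ⟨x, hx, h ▸ hy⟩
  have hnempty : ∀ y ∈ Y, ¬ (P.women y).Prefers ((daPushUp P m ∅).symm y) m := fun y hy h =>
    hmin y hy (daPushUp_erase_eq hY (Finset.empty_subset _) fun _ => h)
  have hz : ∀ y ∈ Y, ∃ z ∈ Z, (P.women y).Prefers ((daPushUp P m {z}).symm y) m := fun y hy =>
    (key Z hZ hYZ.symm y (prefers_daPushUp_symm hY (hne y hy) (Or.inr hy))).resolve_left
      (hnempty y hy)
  choose! f hfZ hf using hz
  refine Finset.card_le_card_of_injOn f hfZ ?_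
  -- If `v` serves `u`, the matching of `{v}` satisfies the constraint that defines the matching of
  -- `{u}` as a minimum.
  have hle : ∀ u ∈ noRegretSet P m, ∀ v ∈ noRegretSet P m,
      (P.women u).Prefers ((daPushUp P m {v}).symm u) m →
      WomenWeaklyPrefer P (daPushUp P m {v}) (daPushUp P m {u}) := by
    intro u hu v hv h
    have hv' := Finset.singleton_subset_iff.2 hv
    refine womenWeaklyPrefer_daPushUp (Finset.singleton_subset_iff.2 hu) (daPushUp_isStable hv')
      (daPushUp_apply hv') fun w hw _ => ?_
    rw [Finset.mem_singleton.1 hw]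
    exact lt_asymm h
  have hlift : ∀ u μ ν, WomenWeaklyPrefer P μ ν → (P.women u).Prefers (ν.symm u) m →
      (P.women u).Prefers (μ.symm u) m := by
    intro u μ ν h h'
    exact lt_of_le_of_lt ((P.women u).weaklyPrefers_iff_le.1 (h u)) h'
  -- two women of `Y` one of which is served by pushing up the other one are equal
  have huniq : ∀ y ∈ Y, ∀ y' ∈ Y, (P.women y).Prefers ((daPushUp P m {y'}).symm y) m → y' = y := by
    intro y hy y' hy' h
    by_contra hcon
    exact hmin y hy (daPushUp_erase_eq hY (Z := {y'})
      (Finset.singleton_subset_iff.2 (Finset.mem_erase.2 ⟨hcon, hy'⟩)) fun _ => h)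
  intro y₁ h₁ y₂ h₂ h
  have hz := hZ (hfZ y₁ h₁)
  -- The element of `Z` chosen for `y₁` is dominated by a single element of `Y`. By irredundancy
  -- this element must be `y₁`, and equally `y₂` if the two choices coincide.
  have hback : ∃ y ∈ Y, WomenWeaklyPrefer P (daPushUp P m {y}) (daPushUp P m {f y₁}) := by
    have hne' : f y₁ ≠ da P m := by
      intro h'
      refine hnempty y₁ h₁ (hlift y₁ _ _ ?_ (hf y₁ h₁))
      have he := Finset.empty_subset (noRegretSet P m)
      refine womenWeaklyPrefer_daPushUp (Finset.singleton_subset_iff.2 hz) (daPushUp_isStable he)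
        (daPushUp_apply he) fun w hw hne => absurd ?_ hne
      rw [Finset.mem_singleton.1 hw, h']
    have h3 : (P.women (f y₁)).Prefers ((daPushUp P m Y).symm (f y₁)) m := by
      rw [hYZ]
      exact prefers_daPushUp_symm hZ hne' (Or.inr (hfZ y₁ h₁))
    rcases key Y hY rfl _ h3 with h4 | ⟨y, hy, h4⟩
    -- If the empty set already serves `f y₁`, so does every singleton, and `y₁` itself may be
    -- taken.
    · refine ⟨y₁, h₁, hle _ hz _ (hY h₁) (hlift _ _ _ ?_ h4)⟩
      exact daPushUp_mono (Finset.empty_subset _) (Finset.singleton_subset_iff.2 (hY h₁))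
    · exact ⟨y, hy, hle _ hz _ (hY hy) h4⟩
  obtain ⟨y, hy, hyle⟩ := hback
  have e₁ := huniq y₁ h₁ y hy (hlift _ _ _ hyle (hf y₁ h₁))
  have e₂ := huniq y₂ h₂ y hy (hlift _ _ _ hyle (h ▸ hf y₂ h₂))
  exact e₁.symm.trans e₂

theorem GreedyReturns.isMinimumNoRegretPushUpSet {n : ℕ} {P : Profile n} {m : Fin n}
    {Y : Finset (Fin n)} (h : GreedyReturns P m Y) : IsMinimumNoRegretPushUpSet P m Y := by
  obtain ⟨hreach, hterm⟩ := h
  have hY : Y ⊆ noRegretSet P m ∧ daPushUp P m Y = daPushUp P m (noRegretSet P m) := by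
    clear hterm
    induction hreach with
    | refl => exact ⟨subset_rfl, rfl⟩
    | tail _ hstep ih =>
      obtain ⟨w, -, rfl, heq⟩ := hstep
      exact ⟨(Finset.erase_subset _ _).trans ih.1, heq⟩
  refine ⟨hY.1, hY.2, fun Z hZ hZeq => ?_⟩
  refine card_le_card_of_daPushUp_eq hY.1 hZ (hY.2.trans hZeq.symm) fun y hy h => ?_
  exact hterm _ ⟨y, hy, rfl, h.trans hY.2⟩

/-! ## Reasoning about programs -/

section Machine

variable {R T : Type}

/-- The command may assign to the register `r`. -/
def Cmd.writesReg [DecidableEq R] (r : R) : Cmd R T → Bool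
  | .skip => false
  | .set r' _ => decide (r' = r)
  | .store _ _ _ _ => false
  | .seq c d => c.writesReg r || d.writesReg r
  | .ite _ c d => c.writesReg r || d.writesReg r
  | .while _ c => c.writesReg r

/-- The command may assign to entries of the table `t`. -/
def Cmd.writesTab [DecidableEq T] (t : T) : Cmd R T → Bool
  | .skip => false
  | .set _ _ => false
  | .store t' _ _ _ => decide (t' = t)
  | .seq c d => c.writesTab t || d.writesTab t
  | .ite _ c d => c.writesTab t || d.writesTab t
  | .while _ c => c.writesTab t

/-- A command without loops. -/
def Cmd.loopFree : Cmd R T → Bool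
  | .skip => true
  | .set _ _ => true
  | .store _ _ _ _ => true
  | .seq c d => c.loopFree && d.loopFree
  | .ite _ c d => c.loopFree && d.loopFree
  | .while _ _ => false

/-- A bound for the running time of a command without loops. -/
def Cmd.size : Cmd R T → ℕ
  | .skip => 1
  | .set _ e => e.cost + 1
  | .store _ i j e => i.cost + j.cost + e.cost + 1
  | .seq c d => c.size + d.size
  | .ite b c d => b.cost + 1 + (c.size + d.size)
  | .while _ _ => 0

/-- The effect of a command without loops. -/
def Cmd.apply [DecidableEq R] [DecidableEq T] : Cmd R T → State R T → State R T
  | .skip, s => s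
  | .set r e, s => s.setReg r (e.eval s)
  | .store t i j e, s => s.setCell t (i.eval s) (j.eval s) (e.eval s)
  | .seq c d, s => d.apply (c.apply s)
  | .ite b c d, s => if b.eval s = true then c.apply s else d.apply s
  | .while _ _, s => s

@[simp] theorem State.setReg_reg [DecidableEq R] (s : State R T) (r r' : R) (v : ℕ) :
    (s.setReg r v).reg r' = if r' = r then v else s.reg r' := by
  simp [State.setReg, Function.update_apply]

@[simp] theorem State.setReg_tab [DecidableEq R] (s : State R T) (r : R) (v : ℕ) :
    (s.setReg r v).tab = s.tab :=
  rfl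

@[simp] theorem State.setCell_reg [DecidableEq T] (s : State R T) (t : T) (i j v : ℕ) :
    (s.setCell t i j v).reg = s.reg :=
  rfl

@[simp] theorem State.setCell_tab [DecidableEq T] (s : State R T) (t t' : T)
    (i j v i' j' : ℕ) :
    (s.setCell t i j v).tab t' i' j' =
      if t' = t ∧ i' = i ∧ j' = j then v else s.tab t' i' j' := by
  simp only [State.setCell, Function.update_apply]
  by_cases ht : t' = t
  · subst ht
    by_cases hi : i' = i
    · subst hi
      by_cases hj : j' = j <;> simp [hj]
    · simp [hi]
  · simp [ht]

@[simp] theorem BExpr.eval_lt_iff {s : State R T} {a b : Expr R T} :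
    (BExpr.lt a b).eval s = true ↔ a.eval s < b.eval s := by
  simp [BExpr.eval]

@[simp] theorem BExpr.eval_eq_iff {s : State R T} {a b : Expr R T} :
    (BExpr.eq a b).eval s = true ↔ a.eval s = b.eval s := by
  simp [BExpr.eval]

@[simp] theorem BExpr.eval_not_iff {s : State R T} {b : BExpr R T} :
    b.not.eval s = true ↔ ¬ b.eval s = true := by
  simp [BExpr.eval]

@[simp] theorem BExpr.eval_or_iff {s : State R T} {b c : BExpr R T} :
    (b.or c).eval s = true ↔ b.eval s = true ∨ c.eval s = true := by
  simp [BExpr.eval]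

@[simp] theorem BExpr.eval_and_iff {s : State R T} {b c : BExpr R T} :
    (b.and c).eval s = true ↔ b.eval s = true ∧ c.eval s = true := by
  simp [BExpr.eval]

variable [DecidableEq R] [DecidableEq T]

/-- The command `c`, started in `s`, terminates in a state and after a time that satisfy `Q`. -/
def Runs (c : Cmd R T) (s : State R T) (Q : State R T → ℕ → Prop) : Prop :=
  ∃ s' t, Exec c s s' t ∧ Q s' t

/-- The states `s` and `s'` agree except on the registers and tables that `c` may modify. -/
def SameOutside (c : Cmd R T) (s s' : State R T) : Prop :=
  (∀ r, c.writesReg r = false → s'.reg r = s.reg r) ∧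
    ∀ t, c.writesTab t = false → s'.tab t = s.tab t

theorem SameOutside.refl (c : Cmd R T) (s : State R T) : SameOutside c s s :=
  ⟨fun _ _ => rfl, fun _ _ => rfl⟩

theorem SameOutside.trans {c : Cmd R T} {s s' s'' : State R T} (h : SameOutside c s s')
    (h' : SameOutside c s' s'') : SameOutside c s s'' :=
  ⟨fun r hr => (h'.1 r hr).trans (h.1 r hr), fun t ht => (h'.2 t ht).trans (h.2 t ht)⟩

theorem SameOutside.mono {c d : Cmd R T} {s s' : State R T} (h : SameOutside c s s')
    (hr : ∀ r, d.writesReg r = false → c.writesReg r = false)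
    (ht : ∀ t, d.writesTab t = false → c.writesTab t = false) : SameOutside d s s' :=
  ⟨fun r h1 => h.1 r (hr r h1), fun t h1 => h.2 t (ht t h1)⟩

/-- The frame rule: preservation of untouched registers and tables becomes a syntactic Boolean
check, closed by `rfl` for concrete commands. -/
theorem Exec.sameOutside {c : Cmd R T} {s s' : State R T} {t : ℕ} (h : Exec c s s' t) :
    SameOutside c s s' := by
  induction h with
  | skip s => exact SameOutside.refl _ _
  | set s r e =>
    refine ⟨fun r' hr => ?_, fun _ _ => rfl⟩
    have : r ≠ r' := by simpa [Cmd.writesReg] using hr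
    simp [this.symm]
  | store s t i j e =>
    refine ⟨fun _ _ => rfl, fun t' ht => ?_⟩
    have : t ≠ t' := by simpa [Cmd.writesTab] using ht
    funext i' j'
    simp [this.symm]
  | seq _ _ h1 h2 =>
    refine (h1.mono ?_ ?_).trans (h2.mono ?_ ?_) <;> intro _ h <;>
      simp only [Cmd.writesReg, Cmd.writesTab, Bool.or_eq_false_iff] at h <;> simp [h]
  | ite_true _ _ h1 =>
    refine h1.mono ?_ ?_ <;> intro _ h <;>
      simp only [Cmd.writesReg, Cmd.writesTab, Bool.or_eq_false_iff] at h <;> simp [h]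
  | ite_false _ _ h1 =>
    refine h1.mono ?_ ?_ <;> intro _ h <;>
      simp only [Cmd.writesReg, Cmd.writesTab, Bool.or_eq_false_iff] at h <;> simp [h]
  | while_true _ _ _ h1 h2 => exact (h1.mono (fun _ h => h) (fun _ h => h)).trans h2
  | while_false _ => exact SameOutside.refl _ _

theorem Runs.mono {c : Cmd R T} {s : State R T} {Q Q' : State R T → ℕ → Prop} (h : Runs c s Q)
    (hQ : ∀ s' t, SameOutside c s s' → Q s' t → Q' s' t) : Runs c s Q' := by
  obtain ⟨s', t, he, hq⟩ := h
  exact ⟨s', t, he, hQ s' t he.sameOutside hq⟩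

theorem Runs.seq {c d : Cmd R T} {s : State R T} {Q Q' : State R T → ℕ → Prop} (h : Runs c s Q)
    (h' : ∀ s' t, SameOutside c s s' → Q s' t → Runs d s' (fun s'' t' => Q' s'' (t + t'))) :
    Runs (.seq c d) s Q' := by
  obtain ⟨s', t, he, hq⟩ := h
  obtain ⟨s'', t', he', hq'⟩ := h' s' t he.sameOutside hq
  exact ⟨s'', t + t', .seq he he', hq'⟩

/-- Straight-line code is executed by evaluating `Cmd.apply`. Since `Cmd.size` adds the costs of
both branches, the bound does not depend on the state. -/
theorem exec_apply {c : Cmd R T} (hc : c.loopFree = true) (s : State R T) :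
    ∃ t ≤ c.size, Exec c s (c.apply s) t := by
  induction c generalizing s with
  | skip => exact ⟨_, le_rfl, .skip s⟩
  | set r e => exact ⟨_, le_rfl, .set s r e⟩
  | store t i j e => exact ⟨_, le_rfl, .store s t i j e⟩
  | seq c d hc' hd' =>
    simp only [Cmd.loopFree, Bool.and_eq_true] at hc
    obtain ⟨t, ht, h⟩ := hc' hc.1 s
    obtain ⟨t', ht', h'⟩ := hd' hc.2 (c.apply s)
    exact ⟨t + t', Nat.add_le_add ht ht', .seq h h'⟩
  | ite b c d hc' hd' =>
    simp only [Cmd.loopFree, Bool.and_eq_true] at hc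
    unfold Cmd.apply Cmd.size
    cases hb : b.eval s
    · obtain ⟨t, ht, h⟩ := hd' hc.2 s
      exact ⟨b.cost + 1 + t, by omega, by simpa using .ite_false hb h⟩
    · obtain ⟨t, ht, h⟩ := hc' hc.1 s
      exact ⟨b.cost + 1 + t, by omega, by simpa [hb] using .ite_true hb h⟩
  | _ => simp [Cmd.loopFree] at hc

theorem runs_of_loopFree {c : Cmd R T} (hc : c.loopFree = true) {s : State R T}
    {Q : State R T → ℕ → Prop} (h : ∀ t ≤ c.size, Q (c.apply s) t) : Runs c s Q := by
  obtain ⟨t, ht, he⟩ := exec_apply hc s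
  exact ⟨_, t, he, h t ht⟩

theorem runs_ite {b : BExpr R T} {c d : Cmd R T} {s : State R T} {Q : State R T → ℕ → Prop}
    (h : b.eval s = true → Runs c s (fun s' t => Q s' (b.cost + 1 + t)))
    (h' : b.eval s = false → Runs d s (fun s' t => Q s' (b.cost + 1 + t))) :
    Runs (.ite b c d) s Q := by
  cases hb : b.eval s
  · obtain ⟨s', t, he, hq⟩ := h' hb
    exact ⟨s', _, .ite_false hb he, hq⟩
  · obtain ⟨s', t, he, hq⟩ := h hb
    exact ⟨s', _, .ite_true hb he, hq⟩

/-- A loop whose body decreases the potential `μ` and takes time at most `B`. -/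
theorem runs_while {b : BExpr R T} {c : Cmd R T} (I : State R T → Prop) (μ : State R T → ℕ)
    (B : ℕ) {s : State R T} (h0 : I s)
    (hstep : ∀ s', SameOutside c s s' → I s' → b.eval s' = true →
      Runs c s' (fun s'' t => I s'' ∧ μ s'' < μ s' ∧ t ≤ B)) :
    Runs (.while b c) s (fun s' t => I s' ∧ b.eval s' = false ∧
      t + (B + b.cost + 1) * μ s' ≤ (B + b.cost + 1) * μ s + (b.cost + 1)) := by
  suffices h : ∀ k s', SameOutside c s s' → I s' → μ s' = k →
      Runs (.while b c) s' (fun s'' t => I s'' ∧ b.eval s'' = false ∧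
        t + (B + b.cost + 1) * μ s'' ≤ (B + b.cost + 1) * μ s' + (b.cost + 1)) from
    h _ s (SameOutside.refl _ _) h0 rfl
  intro k
  induction k using Nat.strong_induction_on with
  | _ k ih =>
    intro s' hs' hI hk
    cases hb : b.eval s'
    · exact ⟨s', _, .while_false hb, hI, hb, by omega⟩
    · obtain ⟨s₁, t₁, he₁, hI₁, hμ₁, ht₁⟩ := hstep s' hs' hI hb
      obtain ⟨s₂, t₂, he₂, hI₂, hb₂, ht₂⟩ :=
        ih (μ s₁) (hk ▸ hμ₁) s₁ (hs'.trans he₁.sameOutside) hI₁ rfl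
      refine ⟨s₂, _, .while_true hb he₁ he₂, hI₂, hb₂, ?_⟩
      -- One unit of potential pays for one test and one body. The unused potential stays in the
      -- bound, so nested loops can be amortized.
      have : (B + b.cost + 1) * (μ s₁ + 1) ≤ (B + b.cost + 1) * μ s' := Nat.mul_le_mul_left _ hμ₁
      rw [Nat.mul_add, Nat.mul_one] at this
      omega

/-- A `for` loop, with an invariant that depends on the time spent in the body. -/
theorem runs_for_time {r N : R} {c : Cmd R T} (hrN : N ≠ r) (hr : c.writesReg r = false)
    (hN : c.writesReg N = false) (I : ℕ → State R T → ℕ → Prop) {s : State R T}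
    (h0 : I 0 (s.setReg r 0) 0)
    (hstep : ∀ k s' t, k < s.reg N → SameOutside (Cmd.for r (.reg N) c) s s' → s'.reg r = k →
      I k s' t → Runs c s' (fun s'' t' => I (k + 1) (s''.setReg r (k + 1)) (t + t'))) :
    Runs (Cmd.for r (.reg N) c) s
      (fun s' t => ∃ t', I (s.reg N) s' t' ∧ t ≤ t' + 7 * s.reg N + 6) := by
  have hout : ∀ {s₁ s₂ : State R T}, SameOutside c s₁ s₂ →
      SameOutside (Cmd.for r (.reg N) c) s₁ s₂ := fun h =>
    h.mono (by intro _ h; simp only [Cmd.for, Cmd.writesReg, Bool.or_eq_false_iff] at h; simp [h])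
      (by intro _ h; simp only [Cmd.for, Cmd.writesTab, Bool.or_eq_false_iff] at h; simp [h])
  have hset : ∀ (s : State R T) v, SameOutside (Cmd.for r (.reg N) c) s (s.setReg r v) := by
    refine fun s v => ⟨fun r' h => ?_, fun _ _ => rfl⟩
    have : r ≠ r' := by
      simp only [Cmd.for, Cmd.writesReg, Bool.or_eq_false_iff, decide_eq_false_iff_not] at h
      exact h.1
    simp [this.symm]
  -- Each round costs 7 besides the body: 4 for the test, 3 for the increment. The remaining 6 are 2
  -- for the initialization and 4 for the failing last test.
  suffices h : ∀ d k s' t, k + d = s.reg N → SameOutside (Cmd.for r (.reg N) c) s s' →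
      s'.reg r = k → s'.reg N = s.reg N → I k s' t →
      ∃ s'' t' t'', Exec (.while (.lt (.reg r) (.reg N)) (c ;; .set r (.succ (.reg r)))) s' s'' t' ∧
        I (s.reg N) s'' t'' ∧ t' + t ≤ t'' + 7 * d + 4 by
    obtain ⟨s', t', t'', he, hI, ht⟩ :=
      h (s.reg N) 0 (s.setReg r 0) 0 (by omega) (hset s 0) (by simp) (by simp [hrN]) h0
    exact ⟨s', _, .seq (.set s r (.const 0)) he, t'', hI, by simp only [Expr.cost]; omega⟩
  intro d
  induction d with
  | zero =>
    intro k s' t hk _ hr' hN' hI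
    refine ⟨s', 4, t, .while_false ?_, by rwa [← hk], by omega⟩
    simp only [BExpr.eval, Expr.eval, hr', hN', decide_eq_false_iff_not]
    omega
  | succ d ih =>
    intro k s' t hk hs' hr' hN' hI
    obtain ⟨s₁, t₁, he₁, hI₁⟩ := hstep k s' t (by omega) hs' hr' hI
    have hr₁ : s₁.reg r = k := (he₁.sameOutside.1 r hr).trans hr'
    have hN₁ : s₁.reg N = s.reg N := (he₁.sameOutside.1 N hN).trans hN'
    obtain ⟨s₂, t₂, t₃, he₂, hI₂, ht₂⟩ := ih (k + 1) (s₁.setReg r (k + 1)) (t + t₁) (by omega)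
      ((hs'.trans (hout he₁.sameOutside)).trans (hset _ _)) (by simp) (by simp [hrN, hN₁]) hI₁
    have he : Exec (.set r (.succ (.reg r))) s₁ (s₁.setReg r (k + 1)) 3 := by
      have := Exec.set s₁ r (Expr.succ (.reg r))
      simpa [Expr.eval, Expr.cost, hr₁] using this
    refine ⟨s₂, _, t₃, .while_true ?_ (.seq he₁ he) he₂, hI₂, ?_⟩
    · simp only [BExpr.eval, Expr.eval, hr', hN', decide_eq_true_eq]
      omega
    · simp only [BExpr.cost, Expr.cost]
      omega

/-- A `for` loop whose body takes time at most `B`. -/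
theorem runs_for {r N : R} {c : Cmd R T} (hrN : N ≠ r) (hr : c.writesReg r = false)
    (hN : c.writesReg N = false) (I : ℕ → State R T → Prop) (B : ℕ) {s : State R T}
    (h0 : I 0 (s.setReg r 0))
    (hstep : ∀ k s', k < s.reg N → SameOutside (Cmd.for r (.reg N) c) s s' → s'.reg r = k →
      I k s' → Runs c s' (fun s'' t => I (k + 1) (s''.setReg r (k + 1)) ∧ t ≤ B)) :
    Runs (Cmd.for r (.reg N) c) s
      (fun s' t => I (s.reg N) s' ∧ t ≤ (B + 7) * s.reg N + 6) := by
  refine (runs_for_time hrN hr hN (fun k s' t => I k s' ∧ t ≤ B * k) ⟨h0, by simp⟩ ?_).mono ?_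
  · rintro k s' t hk hs' hr' ⟨hI, ht⟩
    refine (hstep k s' hk hs' hr' hI).mono ?_
    rintro s'' t' - ⟨hI', ht'⟩
    exact ⟨hI', by rw [Nat.mul_succ]; omega⟩
  · rintro s' t - ⟨t', ⟨hI, ht'⟩, ht⟩
    exact ⟨hI, by rw [Nat.add_mul]; omega⟩

end Machine

/-! ## Deferred acceptance with one proposal at a time -/

/-- The situation when the men below `i` have entered: `nx` counts the proposals made by each man,
`hb` gives the engagements, and `cur` is the free man among those who have entered. -/
structure SeqInv {n : ℕ} (P : Profile n) (i : ℕ) (nx : Fin n → ℕ) (hb : Fin n → Option (Fin n))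
    (cur : Option (Fin n)) : Prop where
  outside : ∀ j : Fin n, i ≤ j → nx j = 0
  held : ∀ w j, hb w = some j → (P.men j).toList.idxOf w + 1 = nx j
  better : ∀ j w, (P.men j).toList.idxOf w < nx j →
    ∃ h, hb w = some h ∧ (P.women w).WeaklyPrefers h j
  engaged : ∀ j : Fin n, j < i → cur ≠ some j → ∃ w, hb w = some j
  bound : ∀ w j, hb w = some j → (P.men j).toList.idxOf w ≤ (P.men j).toList.idxOf (da P j)
  free : ∀ c : Fin n, cur = some c →
    c < i ∧ nx c ≤ (P.men c).toList.idxOf (da P c) ∧ ∀ w, hb w ≠ some c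

theorem PrefList.idxOf_lt {n : ℕ} (l : PrefList n) (a : Fin n) : l.toList.idxOf a < n := by
  have := List.idxOf_lt_length_iff.2 (l.mem a)
  rwa [l.length_eq] at this

namespace SeqInv

variable {n : ℕ} {P : Profile n} {i : ℕ} {nx : Fin n → ℕ} {hb : Fin n → Option (Fin n)}

theorem init (P : Profile n) : SeqInv P 0 (fun _ => 0) (fun _ => none) none where
  outside _ _ := rfl
  held _ _ h := by cases h
  better _ _ h := absurd h (Nat.not_lt_zero _)
  engaged _ h := absurd h (Nat.not_lt_zero _)
  bound _ _ h := by cases h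
  free _ h := by cases h

theorem enter (h : SeqInv P i nx hb none) {j : Fin n} (hj : (j : ℕ) = i) :
    SeqInv P (i + 1) nx hb (some j) where
  outside j' hj' := h.outside j' (by omega)
  held := h.held
  better := h.better
  engaged j' hj' hne := by
    refine h.engaged j' ?_ (by simp)
    have : (j : ℕ) ≠ j' := fun h' => hne (by rw [Fin.ext h'])
    omega
  bound := h.bound
  free c hc := by
    cases hc
    have h0 := h.outside j hj.ge
    refine ⟨by omega, by omega, fun w hw => ?_⟩
    have := h.held w j hw
    omega

theorem nx_le {cur : Option (Fin n)} (h : SeqInv P i nx hb cur) (j : Fin n) : nx j ≤ n := by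
  by_cases hj : (j : ℕ) < i
  · by_cases hc : cur = some j
    · exact (h.free j hc).2.1.trans ((P.men j).idxOf_lt _).le
    · obtain ⟨w, hw⟩ := h.engaged j hj hc
      have h1 := h.held w j hw
      have h2 := (P.men j).idxOf_lt w
      omega
  · rw [h.outside j (not_lt.1 hj)]
    exact Nat.zero_le _

/-- Whoever is rejected in favour of a man that has not gone below his deferred acceptance partner
has not reached his own one. -/
theorem idxOf_lt_of_prefers {w c h : Fin n}
    (hc : (P.men c).toList.idxOf w ≤ (P.men c).toList.idxOf (da P c))
    (hh : (P.men h).toList.idxOf w ≤ (P.men h).toList.idxOf (da P h))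
    (hp : (P.women w).Prefers c h) :
    (P.men h).toList.idxOf w < (P.men h).toList.idxOf (da P h) := by
  refine lt_of_le_of_ne hh fun heq => ?_
  -- If `w` were the final partner of `h`, then `c` and `w` would block the stable matching `da P`.
  have hw := (P.men h).idxOf_inj heq
  have hne : w ≠ da P c := by
    intro h'
    rw [(da P).injective (h'.symm.trans hw)] at hp
    exact lt_irrefl _ hp
  refine da_isStable P c w (lt_of_le_of_ne hc fun h' => hne ((P.men c).idxOf_inj h')) ?_
  rwa [hw, Equiv.symm_apply_apply, ← hw]

theorem accept_free {c w : Fin n} (h : SeqInv P i nx hb (some c))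
    (hw : (P.men c).toList.idxOf w = nx c) (hwb : hb w = none) :
    SeqInv P i (Function.update nx c (nx c + 1)) (Function.update hb w (some c)) none := by
  obtain ⟨hci, hcb, hcw⟩ := h.free c rfl
  refine ⟨?_, ?_, ?_, ?_, ?_, by simp⟩
  · intro j hj
    have : j ≠ c := by rintro rfl; omega
    rw [Function.update_of_ne this]
    exact h.outside j hj
  · intro w' j hj
    by_cases hww : w' = w
    · subst hww
      rw [Function.update_self] at hj
      cases hj
      rw [Function.update_self, hw]
    · rw [Function.update_of_ne hww] at hj
      have : j ≠ c := by rintro rfl; exact hcw w' hj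
      rw [Function.update_of_ne this]
      exact h.held w' j hj
  · intro j w' hj
    by_cases hww : w' = w
    · subst hww
      refine ⟨c, Function.update_self .., ?_⟩
      by_cases hjc : j = c
      · exact Or.inr hjc.symm
      · rw [Function.update_of_ne hjc] at hj
        obtain ⟨h', hh', -⟩ := h.better j w' hj
        rw [hwb] at hh'
        cases hh'
    · rw [Function.update_of_ne hww]
      refine h.better j w' ?_
      by_cases hjc : j = c
      · subst hjc
        rw [Function.update_self] at hj
        have : (P.men j).toList.idxOf w' ≠ nx j := fun h' =>
          hww ((P.men j).idxOf_inj (h'.trans hw.symm))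
        omega
      · rwa [Function.update_of_ne hjc] at hj
  · intro j hj _
    by_cases hjc : j = c
    · exact ⟨w, by rw [hjc, Function.update_self]⟩
    · obtain ⟨w', hw'⟩ := h.engaged j hj (by simpa using Ne.symm hjc)
      refine ⟨w', ?_⟩
      rwa [Function.update_of_ne]
      rintro rfl
      rw [hwb] at hw'
      cases hw'
  · intro w' j hj
    by_cases hww : w' = w
    · subst hww
      rw [Function.update_self] at hj
      cases hj
      exact hw.le.trans hcb
    · rw [Function.update_of_ne hww] at hj
      exact h.bound w' j hj

/-- The dismissed man `b` becomes free. `idxOf_lt_of_prefers` shows that `w` was strictly above his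
final partner, so his advanced counter still respects the bound. -/
theorem displace {c w b : Fin n} (h : SeqInv P i nx hb (some c))
    (hw : (P.men c).toList.idxOf w = nx c) (hwb : hb w = some b)
    (hp : (P.women w).Prefers c b) :
    SeqInv P i (Function.update nx c (nx c + 1)) (Function.update hb w (some c)) (some b) := by
  obtain ⟨hci, hcb, hcw⟩ := h.free c rfl
  have hbc : b ≠ c := by rintro rfl; exact hcw w hwb
  refine ⟨?_, ?_, ?_, ?_, ?_, ?_⟩
  · intro j hj
    have : j ≠ c := by rintro rfl; omega
    rw [Function.update_of_ne this]
    exact h.outside j hj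
  · intro w' j hj
    by_cases hww : w' = w
    · subst hww
      rw [Function.update_self] at hj
      cases hj
      rw [Function.update_self, hw]
    · rw [Function.update_of_ne hww] at hj
      have : j ≠ c := by rintro rfl; exact hcw w' hj
      rw [Function.update_of_ne this]
      exact h.held w' j hj
  · intro j w' hj
    by_cases hww : w' = w
    · subst hww
      refine ⟨c, Function.update_self .., ?_⟩
      by_cases hjc : j = c
      · exact Or.inr hjc.symm
      · rw [Function.update_of_ne hjc] at hj
        obtain ⟨h', hh', hp'⟩ := h.better j w' hj
        rw [hwb] at hh'
        cases hh'
        exact Or.inl (lt_of_lt_of_le hp ((P.women w').weaklyPrefers_iff_le.1 hp'))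
    · rw [Function.update_of_ne hww]
      refine h.better j w' ?_
      by_cases hjc : j = c
      · subst hjc
        rw [Function.update_self] at hj
        have : (P.men j).toList.idxOf w' ≠ nx j := fun h' =>
          hww ((P.men j).idxOf_inj (h'.trans hw.symm))
        omega
      · rwa [Function.update_of_ne hjc] at hj
  · intro j hj hjb
    by_cases hjc : j = c
    · exact ⟨w, by rw [hjc, Function.update_self]⟩
    · obtain ⟨w', hw'⟩ := h.engaged j hj (by simpa using Ne.symm hjc)
      refine ⟨w', ?_⟩
      rwa [Function.update_of_ne]
      rintro rfl
      exact hjb (hwb.symm.trans hw')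
  · intro w' j hj
    by_cases hww : w' = w
    · subst hww
      rw [Function.update_self] at hj
      cases hj
      exact hw.le.trans hcb
    · rw [Function.update_of_ne hww] at hj
      exact h.bound w' j hj
  · intro j hj
    cases hj
    have h1 := h.held w b hwb
    refine ⟨?_, ?_, ?_⟩
    · by_contra hcon
      have := h.outside b (not_lt.1 hcon)
      omega
    · rw [Function.update_of_ne hbc, ← h1]
      exact idxOf_lt_of_prefers (hw.le.trans hcb) (h.bound w b hwb) hp
    · intro w' hw'
      by_cases hww : w' = w
      · rw [hww, Function.update_self] at hw'
        exact hbc (Option.some.inj hw').symm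
      · rw [Function.update_of_ne hww] at hw'
        have h2 := h.held w' b hw'
        exact hww ((P.men b).idxOf_inj (by omega))

theorem reject {c w b : Fin n} (h : SeqInv P i nx hb (some c))
    (hw : (P.men c).toList.idxOf w = nx c) (hwb : hb w = some b)
    (hp : ¬ (P.women w).Prefers c b) :
    SeqInv P i (Function.update nx c (nx c + 1)) hb (some c) := by
  obtain ⟨hci, hcb, hcw⟩ := h.free c rfl
  have hbc : b ≠ c := by rintro rfl; exact hcw w hwb
  have hp' := (P.women w).prefers_of_not hp hbc.symm
  refine ⟨?_, ?_, ?_, h.engaged, h.bound, ?_⟩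
  · intro j hj
    have : j ≠ c := by rintro rfl; omega
    rw [Function.update_of_ne this]
    exact h.outside j hj
  · intro w' j hj
    have : j ≠ c := by rintro rfl; exact hcw w' hj
    rw [Function.update_of_ne this]
    exact h.held w' j hj
  · intro j w' hj
    by_cases hjc : j = c
    · subst hjc
      rw [Function.update_self] at hj
      by_cases hww : w' = w
      · subst hww
        exact ⟨b, hwb, Or.inl hp'⟩
      · refine h.better j w' ?_
        have : (P.men j).toList.idxOf w' ≠ nx j := fun h' =>
          hww ((P.men j).idxOf_inj (h'.trans hw.symm))
        omega
    · rw [Function.update_of_ne hjc] at hj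
      exact h.better j w' hj
  · intro j hj
    cases hj
    refine ⟨hci, ?_, hcw⟩
    rw [Function.update_self, ← hw]
    exact idxOf_lt_of_prefers (h.bound w b hwb) (hw.le.trans hcb) hp'

/-- When all men have entered and nobody is free, the engagements are those of deferred
acceptance. -/
theorem eq_da (h : SeqInv P n nx hb none) (w : Fin n) : hb w = some ((da P).symm w) := by
  obtain ⟨j, rfl⟩ := (da P).surjective w
  rw [Equiv.symm_apply_apply]
  obtain ⟨w, hw⟩ := h.engaged j j.2 (by simp)
  suffices da P j = w by rwa [this]
  refine (P.men j).idxOf_inj (le_antisymm ?_ (h.bound w j hw))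
  -- The last proposals, at positions `nx j - 1`, form a closed state, so the round-based procedure
  -- stops no later. The invariant `bound` is the reverse inequality.
  have hcl := daState_le_of_closed P (fun j => nx j - 1) ?_ j
  · rw [idxOf_da]
    have := h.held w j hw
    omega
  · intro j w hjw j' hj' hp
    obtain ⟨v, hv⟩ := h.engaged j j.2 (by simp)
    obtain ⟨v', hv'⟩ := h.engaged j' j'.2 (by simp)
    have h1 := h.held v j hv
    have h2 := h.held v' j' hv'
    have h3 : w = v := (P.men j).idxOf_inj (by omega)
    obtain ⟨b, hb, hbj⟩ := h.better j' w (by omega)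
    rw [h3, hv] at hb
    cases hb
    exact (P.women w).weaklyPrefers_iff.1 hbj hp

end SeqInv

/-! ## The running time and the result of deferred acceptance -/

theorem encodeLists_eq {n : ℕ} (f : Fin n → PrefList n) (i w : Fin n) {j : ℕ}
    (h : (f i).toList[j]? = some w) : encodeLists f i j = w := by
  simp [encodeLists, h]

theorem PrefList.exists_getElem? {n : ℕ} (l : PrefList n) {j : ℕ} (hj : j < n) :
    ∃ w, l.toList[j]? = some w ∧ l.toList.idxOf w = j := by
  have hj' : j < l.toList.length := by rwa [l.length_eq]
  exact ⟨l.toList[j], by simp, l.nodup.idxOf_getElem j hj'⟩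

/-- The input and the precomputed positions are in place. -/
structure Ready {n : ℕ} (P : Profile n) (m : Fin n) (s : State Reg Tab) : Prop where
  n_eq : s.reg .n = n
  acc_eq : s.reg .acc = m
  mp_eq : s.tab .mp = encodeLists P.men
  rank_eq : ∀ w j : Fin n, s.tab .rank w j = (P.women w).toList.idxOf j
  mrank_eq : ∀ w : Fin n, s.tab .mrank 0 w = (P.men m).toList.idxOf w

theorem Ready.of_sameOutside {n : ℕ} {P : Profile n} {m : Fin n} {s s' : State Reg Tab}
    {c : Cmd Reg Tab} (h : Ready P m s) (hs : SameOutside c s s')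
    (hc : (c.writesReg .n || c.writesReg .acc || c.writesTab .mp || c.writesTab .rank ||
      c.writesTab .mrank) = false) : Ready P m s' := by
  simp only [Bool.or_eq_false_iff] at hc
  obtain ⟨⟨⟨⟨h1, h2⟩, h3⟩, h4⟩, h5⟩ := hc
  refine ⟨?_, ?_, ?_, ?_, ?_⟩
  · rw [hs.1 _ h1, h.n_eq]
  · rw [hs.1 _ h2, h.acc_eq]
  · rw [hs.2 _ h3, h.mp_eq]
  · rw [hs.2 _ h4]; exact h.rank_eq
  · rw [hs.2 _ h5]; exact h.mrank_eq

/-- The table `strat` begins with the list `L`. -/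
def Holds {n : ℕ} (s : State Reg Tab) (L : List (Fin n)) : Prop :=
  ∀ (k : ℕ) (w : Fin n), L[k]? = some w → s.tab .strat 0 k = w

theorem Holds.of_sameOutside {n : ℕ} {L : List (Fin n)} {s s' : State Reg Tab}
    {c : Cmd Reg Tab} (h : Holds s L) (hs : SameOutside c s s')
    (hc : c.writesTab .strat = false) : Holds s' L := by
  unfold Holds
  rw [hs.2 _ hc]
  exact h

namespace Program

/-- The body of the inner loop of `runDA`: one proposal. -/
def proposeStep : Cmd Reg Tab :=
  .ite (.eq (v .cur) (v .acc))
    (.set .w (at1 .strat (at1 .next (v .cur))))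
    (.set .w (.cell .mp (v .cur) (at1 .next (v .cur)))) ;;
  put1 .next (v .cur) (.succ (at1 .next (v .cur))) ;;
  .set .h (at1 .husb (v .w)) ;;
  .ite (.eq (v .h) (v .n))
    (put1 .husb (v .w) (v .cur) ;; .set .active (.const 0))
    (.ite (.lt (.cell .rank (v .w) (v .cur)) (.cell .rank (v .w) (v .h)))
      (put1 .husb (v .w) (v .cur) ;; .set .cur (v .h))
      .skip)

/-- The body of the outer loop of `runDA`: the man `i` enters. -/
def enterStep : Cmd Reg Tab :=
  .set .cur (v .i) ;; .set .active (.const 1) ;; .while (.eq (v .active) (.const 1)) proposeStep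

theorem runDA_eq : runDA =
    (.for .i (v .n) (put1 .next (v .i) (.const 0) ;; put1 .husb (v .i) (v .n)) ;;
      .for .i (v .n) enterStep) :=
  rfl

/-- The effect of one proposal in bare numbers, separating the machine semantics from the matching
argument. The value `n` in `husb` stands for a free woman. -/
theorem proposeStep_apply {s : State Reg Tab} {c k w b : ℕ} (hc : s.reg .cur = c)
    (hk : s.tab .next 0 c = k)
    (hw : (if c = s.reg .acc then s.tab .strat 0 k else s.tab .mp c k) = w)
    (hb : s.tab .husb 0 w = b) :
    (proposeStep.apply s).tab .next 0 = Function.update (s.tab .next 0) c (k + 1) ∧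
    (b = s.reg .n → (proposeStep.apply s).tab .husb 0 = Function.update (s.tab .husb 0) w c ∧
      (proposeStep.apply s).reg .active = 0) ∧
    (b ≠ s.reg .n → s.tab .rank w c < s.tab .rank w b →
      (proposeStep.apply s).tab .husb 0 = Function.update (s.tab .husb 0) w c ∧
      (proposeStep.apply s).reg .cur = b ∧
      (proposeStep.apply s).reg .active = s.reg .active) ∧
    (b ≠ s.reg .n → ¬ s.tab .rank w c < s.tab .rank w b →
      (proposeStep.apply s).tab .husb 0 = s.tab .husb 0 ∧
      (proposeStep.apply s).reg .cur = c ∧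
      (proposeStep.apply s).reg .active = s.reg .active) := by
  subst hc hk
  have h1 : ((Cmd.ite (.eq (v .cur) (v .acc))
    (.set .w (at1 .strat (at1 .next (v .cur))))
    (.set .w (.cell .mp (v .cur) (at1 .next (v .cur))))) : Cmd Reg Tab).apply s =
      s.setReg .w w := by
    by_cases h : s.reg .cur = s.reg .acc
    · simp only [h, if_true] at hw
      simp [Cmd.apply, Expr.eval, h, hw]
    · simp only [h, if_false] at hw
      simp [Cmd.apply, Expr.eval, h, hw]
  unfold proposeStep
  rw [Cmd.apply, h1]
  refine ⟨?_, ?_, ?_, ?_⟩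
  · funext j
    simp only [Cmd.apply, BExpr.eval_eq_iff, BExpr.eval_lt_iff, Expr.eval]
    split_ifs <;> simp [Function.update_apply]
  · rintro h
    refine ⟨funext fun j => ?_, ?_⟩ <;>
      simp [Cmd.apply, Expr.eval, hb, h, Function.update_apply]
  · rintro h h'
    refine ⟨funext fun j => ?_, ?_, ?_⟩ <;>
      simp [Cmd.apply, Expr.eval, hb, h, h', Function.update_apply]
  · rintro h h'
    refine ⟨funext fun j => ?_, ?_, ?_⟩ <;>
      simp [Cmd.apply, Expr.eval, hb, h, h']

/-- The tables `next` and `husb` represent the given situation. -/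
def Represents {n : ℕ} (s : State Reg Tab) (nx : Fin n → ℕ) (hb : Fin n → Option (Fin n)) : Prop :=
  (∀ j : Fin n, s.tab .next 0 j = nx j) ∧
    ∀ w : Fin n, s.tab .husb 0 w = (hb w).elim n (fun j => (j : ℕ))

/-- The invariant of the inner loop of `runDA`. -/
def ProposeInv {n : ℕ} (Q : Profile n) (i : ℕ) (s : State Reg Tab) : Prop :=
  ∃ nx hb cur, SeqInv Q i nx hb cur ∧ Represents s nx hb ∧
    ((cur = none ∧ s.reg .active = 0) ∨ ∃ c, cur = some c ∧ s.reg .active = 1 ∧ s.reg .cur = c)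

/-- The number of proposals that can still be made. -/
def potential (n : ℕ) (s : State Reg Tab) : ℕ :=
  n * n - ∑ j : Fin n, s.tab .next 0 j

theorem runs_proposeStep {n : ℕ} {P : Profile n} {m : Fin n} {l : PrefList n} {i : ℕ}
    {s : State Reg Tab} (hs : Ready P m s) (hl : Holds s l.toList)
    (hI : ProposeInv (misreport P m l) i s) (hactive : s.reg .active = 1) :
    Runs proposeStep s (fun s' t => ProposeInv (misreport P m l) i s' ∧
      potential n s' < potential n s ∧ t ≤ 60) := by
  obtain ⟨nx, hb, cur, hinv, ⟨hnx, hhb⟩, hcur⟩ := hI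
  obtain ⟨c, rfl, -, hc⟩ := hcur.resolve_left (by rintro ⟨-, h⟩; omega)
  refine runs_of_loopFree rfl fun t ht => ?_
  have htime : t ≤ 60 := ht.trans (by decide)
  -- A free man has not passed his final partner, so he still has a woman to propose to.
  have hlt : nx c < n :=
    (hinv.free c rfl).2.1.trans_lt ((PrefList.idxOf_lt _ _))
  obtain ⟨w, hw, hwi⟩ := ((misreport P m l).men c).exists_getElem? hlt
  have hw' : (if (c : ℕ) = s.reg .acc then s.tab .strat 0 (nx c) else s.tab .mp c (nx c)) = w := by
    rw [hs.acc_eq]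
    by_cases hcm : c = m
    · subst hcm
      rw [if_pos rfl]
      exact hl _ _ (by simpa [misreport] using hw)
    · rw [if_neg (fun h => hcm (Fin.ext h)), hs.mp_eq]
      exact encodeLists_eq _ _ _ (by simpa [misreport, Function.update_of_ne hcm] using hw)
  obtain ⟨h1, h2, h3, h4⟩ := proposeStep_apply hc (hnx c) hw' (hhb w)
  generalize proposeStep.apply s = s' at h1 h2 h3 h4
  rw [hs.n_eq] at h2 h3 h4
  have hnx' : ∀ j : Fin n, s'.tab .next 0 j = Function.update nx c (nx c + 1) j := by
    intro j
    simp only [h1, Function.update_apply, hnx, Fin.val_inj]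
  have hhb' : s'.tab .husb 0 = Function.update (s.tab .husb 0) w c →
      ∀ w' : Fin n, s'.tab .husb 0 w' =
        (Function.update hb w (some c) w').elim n (fun j => (j : ℕ)) := by
    intro h w'
    rw [h]
    by_cases hww : w' = w
    · simp [hww]
    · rw [Function.update_of_ne hww, Function.update_of_ne (fun h => hww (Fin.ext h)), hhb]
  -- The truncated subtraction in `potential` strictly decreases because the sum of the counters,
  -- even after the proposal, is at most `n * n`.
  have key : ∀ hb' cur', SeqInv (misreport P m l) i (Function.update nx c (nx c + 1)) hb' cur' →
      potential n s' < potential n s := by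
    intro hb' cur' h
    have hsum' : ∑ j, s'.tab .next 0 (j : Fin n) = ∑ j, nx j + 1 := by
      simp only [hnx']
      rw [Finset.sum_update_of_mem (Finset.mem_univ c), ← Finset.erase_eq,
        ← Finset.add_sum_erase Finset.univ nx (Finset.mem_univ c)]
      omega
    have hsum : ∑ j, s.tab .next 0 (j : Fin n) = ∑ j, nx j := by simp only [hnx]
    have hle : ∑ j, s'.tab .next 0 (j : Fin n) ≤ n * n := by
      simp only [hnx']
      refine (Finset.sum_le_sum fun j _ => h.nx_le j).trans ?_
      simp
    unfold potential
    omega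
  cases hbw : hb w with
  | none =>
    obtain ⟨h5, h6⟩ := h2 (by simp [hbw])
    have h := hinv.accept_free hwi hbw
    exact ⟨⟨_, _, none, h, ⟨hnx', hhb' h5⟩, Or.inl ⟨rfl, h6⟩⟩, key _ _ h, htime⟩
  | some b =>
    have hbn : (hb w).elim n (fun j => (j : ℕ)) ≠ n := by
      rw [hbw]
      exact b.2.ne
    rw [hbw] at h3 h4 hbn
    simp only [Option.elim_some, hs.rank_eq] at h3 h4 hbn
    by_cases hp : (P.women w).Prefers c b
    · obtain ⟨h5, h6, h7⟩ := h3 hbn hp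
      have h := hinv.displace hwi hbw hp
      exact ⟨⟨_, _, some b, h, ⟨hnx', hhb' h5⟩, Or.inr ⟨b, rfl, h7.trans hactive, h6⟩⟩,
        key _ _ h, htime⟩
    · obtain ⟨h5, h6, h7⟩ := h4 hbn hp
      have h := hinv.reject hwi hbw hp
      exact ⟨⟨_, _, some c, h, ⟨hnx', by rw [h5]; exact hhb⟩,
        Or.inr ⟨c, rfl, h7.trans hactive, h6⟩⟩, key _ _ h, htime⟩

theorem runs_enterStep {n : ℕ} {P : Profile n} {m : Fin n} {l : PrefList n} {i : Fin n}
    {s : State Reg Tab} (hs : Ready P m s) (hl : Holds s l.toList) (hi : s.reg .i = i)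
    {nx : Fin n → ℕ} {hb : Fin n → Option (Fin n)}
    (hinv : SeqInv (misreport P m l) i nx hb none) (hrep : Represents s nx hb) :
    Runs enterStep s (fun s' t =>
      (∃ nx' hb', SeqInv (misreport P m l) (i + 1) nx' hb' none ∧ Represents s' nx' hb') ∧
      t + 64 * potential n s' ≤ 64 * potential n s + 8) := by
  refine Runs.seq (runs_of_loopFree rfl (Q := fun s' t => s' = s.setReg .cur i ∧ t ≤ 2) ?_) ?_
  · exact fun t ht => ⟨by simp [Cmd.apply, Expr.eval, hi], ht⟩
  rintro s' t₁ - ⟨rfl, ht₁⟩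
  refine Runs.seq (runs_of_loopFree rfl
    (Q := fun s' t => s' = (s.setReg .cur i).setReg .active 1 ∧ t ≤ 2) ?_) ?_
  · exact fun t ht => ⟨by simp [Cmd.apply, Expr.eval], ht⟩
  rintro s' t₂ - ⟨rfl, ht₂⟩
  refine (runs_while (ProposeInv (misreport P m l) (i + 1)) (potential n) 60 ?_ ?_).mono ?_
  · exact ⟨nx, hb, some i, hinv.enter rfl, hrep, Or.inr ⟨i, rfl, by simp, by simp⟩⟩
  · intro s' hs' hI hb
    have hs₁ : Ready P m ((s.setReg .cur i).setReg .active 1) :=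
      ⟨by simp [hs.n_eq], by simp [hs.acc_eq], hs.mp_eq, hs.rank_eq, hs.mrank_eq⟩
    have hl₁ : Holds ((s.setReg .cur i).setReg .active 1) l.toList := hl
    refine runs_proposeStep (hs₁.of_sameOutside hs' rfl) (hl₁.of_sameOutside hs' rfl) hI ?_
    simpa [Expr.eval] using hb
  · rintro s' t - ⟨⟨nx', hb', cur, h, hrep', hcur⟩, hb, ht⟩
    have hpot : potential n ((s.setReg .cur i).setReg .active 1) = potential n s := rfl
    rw [hpot] at ht
    -- A proposal costs 60 plus 4 for the test, giving 64. The constant 8 covers two assignments and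
    -- the last test.
    simp only [BExpr.cost, Expr.cost] at ht
    refine ⟨⟨nx', hb', ?_, hrep'⟩, by omega⟩
    rcases hcur with ⟨rfl, -⟩ | ⟨c, -, h1, -⟩
    · exact h
    · simp [← Bool.not_eq_true, Expr.eval, h1] at hb

/-- The proposal potential is shared by all entering men: the inner loops together make at most `n *
n` proposals, although a single one may be long. -/
theorem runs_runDA {n : ℕ} {P : Profile n} {m : Fin n} {l : PrefList n} {s : State Reg Tab}
    (hs : Ready P m s) (hl : Holds s l.toList) :
    Runs runDA s (fun s' t =>
      (∀ w : Fin n, s'.tab .husb 0 w = (da (misreport P m l)).symm w) ∧ t ≤ 200 * (n * n)) := by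
  have hpos : 0 < n := Fin.pos m
  rw [runDA_eq]
  refine Runs.seq (runs_for (N := Reg.n) (by decide) rfl rfl
    (fun k (s' : State Reg Tab) => ∀ j, j < k → s'.tab .next 0 j = 0 ∧ s'.tab .husb 0 j = n) 8 ?_ ?_) ?_
  · exact fun j hj => absurd hj (Nat.not_lt_zero _)
  · intro k s' _ hs' hk hI
    have hn := hs'.1 .n rfl
    refine runs_of_loopFree rfl fun t ht => ⟨fun j hj => ?_, ht.trans (by decide)⟩
    by_cases hjk : j = k
    · simp [Cmd.apply, Expr.eval, hk, hjk, hn, hs.n_eq]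
    · have := hI j (by omega)
      simpa [Cmd.apply, Expr.eval, hk, hjk] using this
  rintro s₁ t₁ hs₁ ⟨hI, ht₁⟩
  have hs₁' := hs.of_sameOutside hs₁ rfl
  have hl₁ := hl.of_sameOutside hs₁ rfl
  rw [hs.n_eq] at hI ht₁
  refine (runs_for_time (N := Reg.n) (by decide) rfl rfl (fun k s' t =>
    (∃ nx hb, SeqInv (misreport P m l) k nx hb none ∧ Represents s' nx hb) ∧
      t + 64 * potential n s' ≤ 64 * (n * n) + 8 * k) ?_ ?_).mono ?_
  · refine ⟨⟨_, _, SeqInv.init _, fun j => (hI j j.2).1, fun w => (hI w w.2).2⟩, ?_⟩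
    have : potential n (s₁.setReg .i 0) ≤ n * n := Nat.sub_le _ _
    omega
  · rintro k s' t hk hs' hki ⟨⟨nx, hb, hinv, hrep⟩, ht⟩
    rw [hs₁'.n_eq] at hk
    refine (runs_enterStep (i := ⟨k, hk⟩) (hs₁'.of_sameOutside hs' rfl)
      (hl₁.of_sameOutside hs' rfl) hki hinv hrep).mono ?_
    rintro s'' t' - ⟨h, ht'⟩
    refine ⟨h, ?_⟩
    have : potential n (s''.setReg .i (k + 1)) = potential n s'' := rfl
    rw [this]
    omega
  · rintro s' t - ⟨t', ⟨⟨nx, hb, hinv, hrep⟩, ht'⟩, ht⟩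
    rw [hs₁'.n_eq] at hinv ht' ht
    refine ⟨fun w => ?_, ?_⟩
    · rw [hrep.2 w, hinv.eq_da w]
      rfl
    · nlinarith

/-! ## The parts of the greedy algorithm -/

theorem runs_prepare {n : ℕ} (P : Profile n) (m : Fin n) :
    Runs prepare (initState P m) (fun s t =>
      Ready P m s ∧ Holds s (P.men m).toList ∧ t ≤ 100 * (n * n)) := by
  have hpos : 0 < n := Fin.pos m
  refine Runs.seq (runs_for (N := Reg.n) (by decide) rfl rfl
    (fun k (s' : State Reg Tab) => ∀ w j : Fin n, (w : ℕ) < k →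
      s'.tab .rank w j = (P.women w).toList.idxOf j) (20 * n) ?_ ?_) ?_
  · exact fun _ _ h => absurd h (Nat.not_lt_zero _)
  · intro i s' hi hs' hri hI
    have hn : s'.reg .n = n := hs'.1 .n rfl
    have hwp : s'.tab .wp = encodeLists P.women := hs'.2 .wp rfl
    change i < n at hi
    refine (runs_for (N := Reg.n) (by decide) rfl rfl
      (fun k (s'' : State Reg Tab) => ∀ w j : Fin n,
        ((w : ℕ) < i ∨ (w : ℕ) = i ∧ (P.women w).toList.idxOf j < k) →
        s''.tab .rank w j = (P.women w).toList.idxOf j) 6 ?_ ?_).mono ?_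
    · intro w j h
      exact hI w j (by simpa using h)
    · intro k s'' hk hs'' hrk hI'
      rw [hn] at hk
      have hri' : s''.reg .i = i := (hs''.1 .i rfl).trans hri
      have hwp' : s''.tab .wp = encodeLists P.women := (hs''.2 .wp rfl).trans hwp
      refine runs_of_loopFree rfl fun t ht => ⟨fun w j h => ?_, ht.trans (by decide)⟩
      obtain ⟨u, hu, hui⟩ := (P.women ⟨i, hi⟩).exists_getElem? hk
      have henc : encodeLists P.women i k = u := encodeLists_eq P.women ⟨i, hi⟩ u hu
      by_cases hw : w = ⟨i, hi⟩ ∧ j = u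
      · obtain ⟨rfl, rfl⟩ := hw
        simp [Cmd.apply, Expr.eval, hri', hrk, hwp', henc, hui]
      · have h1 : ¬ ((w : ℕ) = i ∧ (j : ℕ) = u) :=
          fun h' => hw ⟨Fin.ext h'.1, Fin.ext h'.2⟩
        simp only [Cmd.apply, Expr.eval, hri', hrk, hwp', henc, State.setReg_tab,
          State.setCell_tab, true_and, if_neg h1]
        refine hI' w j (h.imp_right fun h2 => ⟨h2.1, ?_⟩)
        refine lt_of_le_of_ne (Nat.lt_succ_iff.1 h2.2) fun h3 => ?_
        have hwi : w = ⟨i, hi⟩ := Fin.ext h2.1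
        subst hwi
        exact hw ⟨rfl, (P.women _).idxOf_inj (h3.trans hui.symm)⟩
    · rintro s'' t - ⟨h, ht⟩
      rw [hn] at h ht
      refine ⟨fun w j hw => h w j ?_, by omega⟩
      rcases (Nat.lt_succ_iff.1 hw).lt_or_eq with h1 | h1
      · exact Or.inl h1
      · exact Or.inr ⟨h1, (P.women w).idxOf_lt j⟩
  rintro s₁ t₁ hs₁ ⟨hrank, ht₁⟩
  have hn : s₁.reg .n = n := hs₁.1 .n rfl
  have hacc : s₁.reg .acc = m := hs₁.1 .acc rfl
  have hmp : s₁.tab .mp = encodeLists P.men := hs₁.2 .mp rfl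
  change t₁ ≤ (20 * n + 7) * n + 6 at ht₁
  change ∀ w j : Fin n, (w : ℕ) < n → s₁.tab .rank w j = (P.women w).toList.idxOf j at hrank
  refine (runs_for (N := Reg.n) (by decide) rfl rfl
    (fun k (s' : State Reg Tab) =>
      (∀ w : Fin n, (P.men m).toList.idxOf w < k →
        s'.tab .mrank 0 w = (P.men m).toList.idxOf w) ∧
      ∀ (j : ℕ) (w : Fin n), j < k → (P.men m).toList[j]? = some w → s'.tab .strat 0 j = w)
    20 ?_ ?_).mono ?_
  · exact ⟨fun _ h => absurd h (Nat.not_lt_zero _), fun _ _ h => absurd h (Nat.not_lt_zero _)⟩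
  · rintro k s' hk hs' hrk ⟨hI, hJ⟩
    rw [hn] at hk
    have hacc' : s'.reg .acc = m := (hs'.1 .acc rfl).trans hacc
    have hmp' : s'.tab .mp = encodeLists P.men := (hs'.2 .mp rfl).trans hmp
    obtain ⟨u, hu, hui⟩ := (P.men m).exists_getElem? hk
    have henc : encodeLists P.men m k = u := encodeLists_eq P.men m u hu
    refine runs_of_loopFree rfl fun t ht => ⟨⟨fun w hw => ?_, fun j w hj hw => ?_⟩,
      ht.trans (by decide)⟩
    · by_cases hwu : w = u
      · simp [Cmd.apply, Expr.eval, hacc', hmp', hrk, henc, hwu, hui]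
      · have h1 : (w : ℕ) ≠ u := fun h => hwu (Fin.ext h)
        have h2 : (P.men m).toList.idxOf w ≠ k := fun h =>
          hwu ((P.men m).idxOf_inj (h.trans hui.symm))
        simpa [Cmd.apply, Expr.eval, hacc', hmp', hrk, henc, h1] using hI w (by omega)
    · by_cases hjk : j = k
      · subst hjk
        rw [hu] at hw
        cases hw
        simp [Cmd.apply, Expr.eval, hacc', hmp', hrk, henc]
      · simpa [Cmd.apply, Expr.eval, hacc', hmp', hrk, henc, hjk] using hJ j w (by omega) hw
  · rintro s' t hs' ⟨⟨hI, hJ⟩, ht⟩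
    rw [hn] at hI hJ ht
    refine ⟨⟨?_, ?_, ?_, ?_, fun w => hI w ((P.men m).idxOf_lt w)⟩, fun j w h => ?_, ?_⟩
    · rw [hs'.1 _ rfl, hn]
    · rw [hs'.1 _ rfl, hacc]
    · rw [hs'.2 _ rfl, hmp]
    · rw [hs'.2 _ rfl]
      exact fun w j => hrank w j w.2
    · refine hJ j w ?_ h
      have := (List.getElem?_eq_some_iff.1 h).1
      rwa [(P.men m).length_eq] at this
    · nlinarith

theorem runs_findPartner {n : ℕ} {m : Fin n} {s : State Reg Tab} (hn : s.reg .n = n)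
    (hacc : s.reg .acc = m) {μ : Fin n ≃ Fin n} (hμ : ∀ w : Fin n, s.tab .husb 0 w = μ.symm w)
    {r : Reg} (hr : r = .a ∨ r = .r) :
    Runs (findPartner r) s (fun s' t => s'.reg r = μ m ∧ t ≤ 30 * n) := by
  have hpos : 0 < n := Fin.pos m
  have hri : r ≠ .i := by rcases hr with rfl | rfl <;> decide
  have hrn : (Cmd.writesReg .n (.ite (.eq (at1 .husb (v .i)) (v .acc)) (.set r (v .i)) .skip)) =
      false := by rcases hr with rfl | rfl <;> rfl
  have hri' : (Cmd.writesReg .i (.ite (.eq (at1 .husb (v .i)) (v .acc)) (.set r (v .i)) .skip)) =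
      false := by rcases hr with rfl | rfl <;> rfl
  refine (runs_for (N := Reg.n) (by decide) hri' hrn
    (fun k (s' : State Reg Tab) => (μ m : ℕ) < k → s'.reg r = μ m) 9 ?_ ?_).mono ?_
  · exact fun h => absurd h (Nat.not_lt_zero _)
  · intro k s' hk hs' hki hI
    have hacc' : s'.reg .acc = m := by
      refine (hs'.1 .acc ?_).trans hacc
      rcases hr with rfl | rfl <;> rfl
    rw [hn] at hk
    have hhusb : s'.tab .husb 0 k = μ.symm ⟨k, hk⟩ := by
      rw [hs'.2 .husb rfl]
      exact hμ ⟨k, hk⟩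
    have hiff : ((μ.symm ⟨k, hk⟩ : Fin n) : ℕ) = m ↔ k = μ m := by
      rw [Fin.val_inj, Equiv.symm_apply_eq, ← Fin.val_inj]
    refine runs_of_loopFree rfl fun t ht => ⟨fun h => ?_, ht.trans (by rfl)⟩
    have hcond : (BExpr.eq (at1 .husb (v .i)) (v .acc)).eval s' = true ↔ k = μ m := by
      simp only [BExpr.eval_eq_iff, Expr.eval, hki, hacc', hhusb]
      exact hiff
    by_cases hkm : k = μ m
    · rw [Cmd.apply, if_pos (hcond.2 hkm)]
      simp [Cmd.apply, Expr.eval, hki, hri, hkm]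
    · rw [Cmd.apply, if_neg (fun h => hkm (hcond.1 h))]
      simpa [Cmd.apply, hri] using hI (by omega)
  · rintro s' t - ⟨h, ht⟩
    rw [hn] at h ht
    exact ⟨h (μ m).2, by omega⟩

/-- The list written so far to the table `strat`. -/
def StratIs {n : ℕ} (s : State Reg Tab) (L : List (Fin n)) : Prop :=
  s.reg .pos = L.length ∧ Holds s L

theorem stratIs_append {n : ℕ} {s : State Reg Tab} {L : List (Fin n)} (h : StratIs s L)
    {e : Expr Reg Tab} {w : Fin n} (he : e.eval s = w) :
    StratIs ((append e).apply s) (L ++ [w]) := by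
  obtain ⟨h1, h2⟩ := h
  refine ⟨by simp [append, Cmd.apply, Expr.eval, h1], fun k u hk => ?_⟩
  by_cases hkL : k = L.length
  · subst hkL
    have : w = u := by simpa using hk
    simp [append, Cmd.apply, Expr.eval, h1, he, this]
  · have hk' : L[k]? = some u := by
      rcases Nat.lt_or_ge k L.length with h | h
      · rwa [List.getElem?_append_left h] at hk
      · rw [List.getElem?_append_right h, List.getElem?_singleton, if_neg (by omega)] at hk
        cases hk
    simpa [append, Cmd.apply, Expr.eval, h1, hkL] using h2 k u hk'

/-- Both halves of a push-up list come from this loop with different tests. The test may depend only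
on data that the loop leaves alone and on the current woman. -/
theorem runs_filterLoop {n : ℕ} {P : Profile n} {m : Fin n} {s : State Reg Tab}
    (hs : Ready P m s) {b : BExpr Reg Tab} {p : Fin n → Bool}
    (hb : ∀ s' : State Reg Tab, s'.reg .a = s.reg .a → s'.tab .mrank = s.tab .mrank →
      s'.tab .ys = s.tab .ys → ∀ w : Fin n, s'.reg .w = w → (b.eval s' = true ↔ p w = true))
    {L : List (Fin n)} (hL : StratIs s L) :
    Runs (.for .i (v .n)
      (.set .w (.cell .mp (v .acc) (v .i)) ;; .ite b (append (v .w)) .skip)) s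
      (fun s' t => StratIs s' (L ++ (P.men m).toList.filter p) ∧
        t ≤ (b.cost + 20) * n + 6) := by
  refine (runs_for (N := Reg.n) (by decide) rfl rfl
    (fun k (s' : State Reg Tab) => StratIs s' (L ++ ((P.men m).toList.take k).filter p))
    (b.cost + 13) ?_ ?_).mono ?_
  · simpa [StratIs, Holds] using hL
  · intro k s' hk hs' hki hI
    have hs₁ := hs.of_sameOutside hs' rfl
    rw [hs.n_eq] at hk
    obtain ⟨w, hw, -⟩ := (P.men m).exists_getElem? hk
    have hset : (Cmd.set .w (.cell .mp (v .acc) (v .i))).apply s' = s'.setReg .w w := by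
      simp [Cmd.apply, Expr.eval, hs₁.acc_eq, hs₁.mp_eq, hki, encodeLists_eq P.men m w hw]
    have hbw := hb (s'.setReg .w w) (hs'.1 .a rfl) (hs'.2 .mrank rfl) (hs'.2 .ys rfl) w (by simp)
    have hcost : ((Cmd.set .w (.cell .mp (v .acc) (v .i)) ;;
        .ite b (append (v .w)) .skip) : Cmd Reg Tab).size = b.cost + 13 := by
      simp only [Cmd.size, Expr.cost, append]
      omega
    refine runs_of_loopFree rfl fun t ht => ⟨?_, ht.trans hcost.le⟩
    rw [Cmd.apply, hset, List.take_add_one, hw, Option.toList_some, List.filter_append]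
    have hI' : StratIs (s'.setReg .w w) (L ++ ((P.men m).toList.take k).filter p) := hI
    have hpad : ∀ s₂ L', StratIs (n := n) s₂ L' → StratIs (s₂.setReg .i (k + 1)) L' :=
      fun _ _ h => h
    refine hpad _ _ ?_
    cases hp : p w
    · have hf : ¬ b.eval (s'.setReg .w w) = true := by rw [hbw, hp]; simp
      simpa [Cmd.apply, hf, hp] using hI'
    · have ht : b.eval (s'.setReg .w w) = true := hbw.2 hp
      rw [Cmd.apply, if_pos ht, List.filter_cons_of_pos hp, List.filter_nil, ← List.append_assoc]
      exact stratIs_append hI' (by simp [Expr.eval])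
  · rintro s' t - ⟨h, ht⟩
    rw [hs.n_eq] at h ht
    rw [List.take_of_length_le (P.men m).length_eq.le] at h
    exact ⟨h, ht⟩

/-- The situation in which the accomplice is to push up the set `X`. -/
structure Current {n : ℕ} (P : Profile n) (m : Fin n) (X : Finset (Fin n))
    (s : State Reg Tab) : Prop where
  ready : Ready P m s
  a_eq : s.reg .a = da P m
  ys_eq : ∀ w : Fin n, s.tab .ys 0 w = if w ∈ X then 1 else 0

theorem Current.of_sameOutside {n : ℕ} {P : Profile n} {m : Fin n} {X : Finset (Fin n)}
    {s s' : State Reg Tab} {c : Cmd Reg Tab} (h : Current P m X s) (hs : SameOutside c s s')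
    (hc : (c.writesReg .n || c.writesReg .acc || c.writesTab .mp || c.writesTab .rank ||
      c.writesTab .mrank) = false) (ha : c.writesReg .a = false) (hys : c.writesTab .ys = false) :
    Current P m X s' :=
  ⟨h.ready.of_sameOutside hs hc, (hs.1 _ ha).trans h.a_eq, by rw [hs.2 _ hys]; exact h.ys_eq⟩

theorem runs_buildPushUp {n : ℕ} {P : Profile n} {m : Fin n} {X : Finset (Fin n)}
    {s : State Reg Tab} (hs : Current P m X s) :
    Runs buildPushUp s (fun s' t => Holds s' (pushUp P m X).toList ∧ t ≤ 100 * n) := by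
  have hpos : 0 < n := Fin.pos m
  have hup : ∀ s₁ : State Reg Tab, Current P m X s₁ → ∀ s' : State Reg Tab,
      s'.reg .a = s₁.reg .a → s'.tab .mrank = s₁.tab .mrank → s'.tab .ys = s₁.tab .ys →
      ∀ w : Fin n, s'.reg .w = w →
      (goesUp.eval s' = true ↔ (P.men m).Prefers w (da P m) ∨ w ∈ X) := by
    intro s₁ h s' ha hm hy w hw
    simp [goesUp, Expr.eval, ha, hm, hy, hw, h.a_eq, h.ready.mrank_eq, h.ys_eq,
      PrefList.Prefers]
  have hne : ∀ s₁ : State Reg Tab, Current P m X s₁ → ∀ s' : State Reg Tab,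
      s'.reg .a = s₁.reg .a → ∀ w : Fin n, s'.reg .w = w →
      ((BExpr.not (.eq (v .w) (v .a))).eval s' = true ↔ w ≠ da P m) := by
    intro s₁ h s' ha w hw
    simp [Expr.eval, ha, hw, h.a_eq, Fin.val_inj]
  refine Runs.seq (runs_of_loopFree rfl
    (Q := fun s' t => s' = s.setReg .pos 0 ∧ t ≤ 2) fun t ht => ⟨rfl, ht⟩) ?_
  rintro s₁ t₁ hs₁ ⟨rfl, ht₁⟩
  have hc₁ := hs.of_sameOutside hs₁ rfl rfl rfl
  refine Runs.seq (runs_filterLoop hc₁.ready (L := [])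
    (p := fun w => decide (w ≠ da P m ∧ ((P.men m).Prefers w (da P m) ∨ w ∈ X)))
    (fun s' h1 h2 h3 w hw => ?_) ⟨by simp, by simp [Holds]⟩) ?_
  · rw [BExpr.eval_and_iff, hne _ hc₁ s' h1 w hw, hup _ hc₁ s' h1 h2 h3 w hw, decide_eq_true_eq]
  rintro s₂ t₂ hs₂ ⟨hL, ht₂⟩
  have hc₂ := hc₁.of_sameOutside hs₂ rfl rfl rfl
  refine Runs.seq (runs_of_loopFree rfl (Q := fun s' t => StratIs s' _ ∧ t ≤ 7)
    fun t ht => ⟨stratIs_append hL (w := da P m) hc₂.a_eq, ht⟩) ?_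
  rintro s₃ t₃ hs₃ ⟨hL₃, ht₃⟩
  have hc₃ := hc₂.of_sameOutside hs₃ rfl rfl rfl
  refine (runs_filterLoop hc₃.ready (L := _)
    (p := fun w => decide (w ≠ da P m ∧ ¬ ((P.men m).Prefers w (da P m) ∨ w ∈ X)))
    (fun s' h1 h2 h3 w hw => ?_) hL₃).mono ?_
  · rw [BExpr.eval_and_iff, BExpr.eval_not_iff (b := goesUp), hne _ hc₃ s' h1 w hw,
      hup _ hc₃ s' h1 h2 h3 w hw, decide_eq_true_eq]
  · rintro s₄ t₄ - ⟨⟨-, hL₄⟩, ht₄⟩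
    refine ⟨?_, ?_⟩
    · simpa [pushUp, PrefList.pushAbove] using hL₄
    · simp only [goesUp, BExpr.cost, Expr.cost] at ht₂ ht₄
      omega

/-- Build the push-up list, run deferred acceptance with it, and go on with `c`. -/
theorem runs_buildPushUp_runDA {n : ℕ} {P : Profile n} {m : Fin n} {X : Finset (Fin n)}
    {s : State Reg Tab} (hs : Current P m X s) {c : Cmd Reg Tab} {Q : State Reg Tab → ℕ → Prop}
    (hc : ∀ s' t, SameOutside (buildPushUp ;; runDA) s s' →
      (∀ w : Fin n, s'.tab .husb 0 w = (daPushUp P m X).symm w) → t ≤ 300 * (n * n) →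
      Runs c s' (fun s'' t' => Q s'' (t + t'))) : Runs (buildPushUp ;; runDA ;; c) s Q := by
  have hpos : 0 < n := Fin.pos m
  have hnn : n ≤ n * n := Nat.le_mul_self n
  refine Runs.seq (runs_buildPushUp hs) ?_
  rintro s₁ t₁ hs₁ ⟨hL, ht₁⟩
  refine Runs.seq (runs_runDA (hs.ready.of_sameOutside hs₁ rfl) hL) ?_
  rintro s₂ t₂ hs₂ ⟨hh, ht₂⟩
  have hout : SameOutside (buildPushUp ;; runDA) s s₂ := by
    refine (hs₁.mono ?_ ?_).trans (hs₂.mono ?_ ?_) <;> intro _ h <;>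
      simp only [Cmd.writesReg, Cmd.writesTab, Bool.or_eq_false_iff] at h
    exacts [h.1, h.1, h.2, h.2]
  refine (hc s₂ (t₁ + t₂) hout hh (by omega)).mono fun s' t _ h => ?_
  rwa [← Nat.add_assoc]

theorem runs_computeNoRegretSet {n : ℕ} {P : Profile n} {m : Fin n} {s : State Reg Tab}
    (hs : Ready P m s) (ha : s.reg .a = da P m) :
    Runs computeNoRegretSet s (fun s' t =>
      (∀ w : Fin n, s'.tab .nr 0 w = if w ∈ noRegretSet P m then 1 else 0) ∧
      t ≤ 500 * (n * n * n)) := by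
  have hpos : 0 < n := Fin.pos m
  refine Runs.seq (runs_for (N := Reg.n) (by decide) rfl rfl
    (fun k (s' : State Reg Tab) => ∀ j, j < k → s'.tab .ys 0 j = 0) 4 ?_ ?_) ?_
  · exact fun j hj => absurd hj (Nat.not_lt_zero _)
  · intro k s' _ _ hk hI
    refine runs_of_loopFree rfl fun t ht => ⟨fun j hj => ?_, ht.trans (by decide)⟩
    by_cases hjk : j = k
    · simp [Cmd.apply, Expr.eval, hk, hjk]
    · simpa [Cmd.apply, Expr.eval, hk, hjk] using hI j (by omega)
  rintro s₁ t₁ hs₁ ⟨hys, ht₁⟩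
  have hr₁ := hs.of_sameOutside hs₁ rfl
  have ha₁ := (hs₁.1 .a rfl).trans ha
  rw [hs.n_eq] at hys ht₁
  -- The indicator `ys` is all zero between iterations, so each iteration pushes up exactly one
  -- singleton.
  refine (runs_for (N := Reg.n) (by decide) rfl rfl
    (fun k (s' : State Reg Tab) => (∀ w : Fin n, s'.tab .ys 0 w = 0) ∧
      ∀ w : Fin n, (w : ℕ) < k → s'.tab .nr 0 w = if w ∈ noRegretSet P m then 1 else 0)
    (400 * (n * n)) ?_ ?_).mono ?_
  · exact ⟨fun w => hys w w.2, fun _ h => absurd h (Nat.not_lt_zero _)⟩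
  · rintro k s' hk hs' hky ⟨hI, hJ⟩
    rw [hr₁.n_eq] at hk
    have hr₂ := hr₁.of_sameOutside hs' rfl
    have ha₂ := (hs'.1 .a rfl).trans ha₁
    refine Runs.seq (runs_of_loopFree rfl
      (Q := fun s'' t => s'' = s'.setCell .ys 0 k 1 ∧ t ≤ 4) ?_) ?_
    · exact fun t ht => ⟨by simp [Cmd.apply, Expr.eval, hky], ht⟩
    rintro s₂ t₂ hs₂ ⟨rfl, ht₂⟩
    have hcur : Current P m {⟨k, hk⟩} (s'.setCell .ys 0 k 1) := by
      refine ⟨hr₂.of_sameOutside hs₂ rfl, ha₂, fun w => ?_⟩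
      simp [hI w, Fin.ext_iff]
    refine runs_buildPushUp_runDA hcur fun s₃ t₃ hs₃ hh ht₃ => ?_
    have hcur₃ := hcur.of_sameOutside hs₃ rfl rfl rfl
    refine Runs.seq (runs_findPartner hcur₃.ready.n_eq hcur₃.ready.acc_eq hh (Or.inr rfl)) ?_
    rintro s₄ t₄ hs₄ ⟨hr, ht₄⟩
    have hcur₄ := hcur₃.of_sameOutside hs₄ rfl rfl rfl
    have hy₄ : s₄.reg .y = k := by
      rw [hs₄.1 _ rfl, hs₃.1 _ rfl]
      exact hky
    have hnr₄ : s₄.tab .nr = s'.tab .nr := by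
      rw [hs₄.2 _ rfl, hs₃.2 _ rfl]
      exact hs₂.2 _ rfl
    refine runs_of_loopFree rfl fun t ht => ⟨⟨fun w => ?_, fun w hw => ?_⟩, ?_⟩
    · have h1 := hcur₄.ys_eq w
      simp only [Cmd.apply]
      split_ifs <;> by_cases hwk : (w : ℕ) = k <;>
        simp [Expr.eval, hy₄, hwk, h1, Fin.ext_iff]
    · have h2 : (⟨k, hk⟩ : Fin n) ∈ noRegretSet P m ↔
          ¬ (P.men m).toList.idxOf (da P m) <
            (P.men m).toList.idxOf (daPushUp P m {⟨k, hk⟩} m) := by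
        rw [mem_noRegretSet, NoRegret, PrefList.weaklyPrefers_iff]
        rfl
      by_cases hwk : (w : ℕ) = k
      · have hwk' : w = ⟨k, hk⟩ := Fin.ext hwk
        rw [hwk', if_congr h2 rfl rfl]
        simp only [Cmd.apply, BExpr.eval_lt_iff, Expr.eval, hcur₄.a_eq, hr,
          hcur₄.ready.mrank_eq]
        split_ifs <;> simp [hy₄]
      · have h3 := hJ w (by omega)
        rw [← h3, ← hnr₄]
        simp only [Cmd.apply]
        split_ifs <;> simp [Expr.eval, hy₄, hwk]
    · have ht' : t ≤ 40 := ht.trans (by decide)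
      nlinarith
  · rintro s' t - ⟨⟨-, h⟩, ht⟩
    rw [hr₁.n_eq] at h ht
    refine ⟨fun w => h w w.2, ?_⟩
    have h1 : n ≤ n * n * n := by nlinarith [Nat.mul_le_mul hpos hpos]
    have h2 : (400 * (n * n) + 7) * n = 400 * (n * n * n) + 7 * n := by ring
    omega

theorem runs_compare {n : ℕ} {s : State Reg Tab} (hn : s.reg .n = n) :
    Runs compare s (fun s' t =>
      (s'.reg .same = 1 ↔ ∀ w : Fin n, s.tab .husb 0 w = s.tab .best 0 w) ∧
      t ≤ 20 * n + 10) := by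
  refine Runs.seq (runs_of_loopFree rfl
    (Q := fun s' t => s' = s.setReg .same 1 ∧ t ≤ 2) fun t ht => ⟨rfl, ht⟩) ?_
  rintro s₁ t₁ hs₁ ⟨rfl, ht₁⟩
  refine (runs_for (N := Reg.n) (by decide) rfl rfl (fun k (s' : State Reg Tab) =>
    (s'.reg .same = 1 ↔ ∀ j, j < k → s.tab .husb 0 j = s.tab .best 0 j)) 13 ?_ ?_).mono ?_
  · simp
  · intro k s' hk hs' hki hI
    have hh : s'.tab .husb = s.tab .husb := hs'.2 _ rfl
    have hb : s'.tab .best = s.tab .best := hs'.2 _ rfl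
    refine runs_of_loopFree rfl fun t ht => ⟨?_, ht.trans (by decide)⟩
    simp only [Nat.lt_succ_iff_lt_or_eq, or_imp, forall_and, forall_eq]
    by_cases hk : s.tab .husb 0 k = s.tab .best 0 k
    · simpa [Cmd.apply, Expr.eval, hh, hb, hki, hk] using hI
    · simp [Cmd.apply, Expr.eval, hh, hb, hki, hk]
  · rintro s' t - ⟨h, ht⟩
    have hn' : (s.setReg .same 1).reg .n = n := by simpa using hn
    rw [hn'] at h ht
    refine ⟨h.trans ⟨fun h w => h w w.2, fun h j hj => h ⟨j, hj⟩⟩, by omega⟩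

/-! ## The greedy algorithm -/

/-- The invariant of the greedy loop: the current set has been reached by successful removals, and
the removals tried since the last restart have failed. -/
def GreedyInv {n : ℕ} (P : Profile n) (m : Fin n) (s : State Reg Tab) : Prop :=
  ∃ Y : Finset (Fin n), (∀ w : Fin n, s.tab .ys 0 w = if w ∈ Y then 1 else 0) ∧
    Relation.ReflTransGen (GreedyStep P m) (noRegretSet P m) Y ∧ s.reg .y ≤ n ∧
    ∀ w ∈ Y, (w : ℕ) < s.reg .y → daPushUp P m (Y.erase w) ≠ daPushUp P m (noRegretSet P m)

/-- Bounds the number of iterations that the greedy loop can still make. -/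
def greedyPotential (n : ℕ) (s : State Reg Tab) : ℕ :=
  (∑ w : Fin n, s.tab .ys 0 w) * (n + 1) + (n - s.reg .y)

theorem sum_ys {n : ℕ} {s : State Reg Tab} {Y : Finset (Fin n)}
    (h : ∀ w : Fin n, s.tab .ys 0 w = if w ∈ Y then 1 else 0) :
    ∑ w : Fin n, s.tab .ys 0 w = Y.card := by
  simp [h]

/-- At most `O(n ^ 2)` attempts, each with one `O(n ^ 2)` run. Removals tried since the last restart
have failed for the current set, so reaching `y = n` certifies that none is possible. -/
theorem runs_greedyLoop {n : ℕ} {P : Profile n} {m : Fin n} {s : State Reg Tab}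
    (hs : Current P m (noRegretSet P m) s)
    (hbest : ∀ w : Fin n, s.tab .best 0 w = (daPushUp P m (noRegretSet P m)).symm w) :
    Runs greedyLoop s (fun s' t => ∃ Y, Current P m Y s' ∧ GreedyReturns P m Y ∧
      t ≤ 2000 * (n * n * n * n)) := by
  have hpos : 0 < n := Fin.pos m
  refine Runs.seq (runs_of_loopFree rfl
    (Q := fun s' t => s' = s.setReg .y 0 ∧ t ≤ 2) fun t ht => ⟨rfl, ht⟩) ?_
  rintro s₁ t₁ hs₁ ⟨rfl, ht₁⟩
  have hc₁ := hs.of_sameOutside hs₁ rfl rfl rfl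
  refine (runs_while (GreedyInv P m) (greedyPotential n) (400 * (n * n)) ?_ ?_).mono ?_
  · exact ⟨_, hc₁.ys_eq, .refl, by simp, fun w _ h => absurd h (by simp)⟩
  · rintro s' hs' ⟨Y, hys, hreach, hyn, hfail⟩ hb
    have hr' := hc₁.ready.of_sameOutside hs' rfl
    have ha' : s'.reg .a = da P m := (hs'.1 _ rfl).trans hc₁.a_eq
    have hbest' : ∀ w : Fin n, s'.tab .best 0 w = (daPushUp P m (noRegretSet P m)).symm w := by
      rw [hs'.2 _ rfl]
      exact hbest
    have hy : s'.reg .y < n := by simpa [Expr.eval, hr'.n_eq] using hb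
    obtain ⟨y, hyy⟩ : ∃ y : Fin n, s'.reg .y = y := ⟨⟨_, hy⟩, rfl⟩
    have hnn : 1 ≤ n * n := Nat.mul_pos hpos hpos
    have hn2 : n ≤ n * n := Nat.le_mul_self n
    -- going on to the next woman
    have hnext : ∀ s'' : State Reg Tab, s''.reg .y = y + 1 →
        (∀ w : Fin n, s''.tab .ys 0 w = if w ∈ Y then 1 else 0) →
        (y ∈ Y → daPushUp P m (Y.erase y) ≠ daPushUp P m (noRegretSet P m)) →
        GreedyInv P m s'' ∧ greedyPotential n s'' < greedyPotential n s' := by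
      intro s'' h1 h2 h3
      refine ⟨⟨Y, h2, hreach, by omega, fun w hw hlt => ?_⟩, ?_⟩
      · by_cases hwy : w = y
        · subst hwy
          exact h3 hw
        · have : (w : ℕ) ≠ y := fun h => hwy (Fin.ext h)
          exact hfail w hw (by omega)
      · unfold greedyPotential
        rw [sum_ys h2, sum_ys hys]
        omega
    refine runs_ite (fun hyY => ?_) (fun hyY => ?_)
    · have hyY' : y ∈ Y := by
        by_contra hcon
        simp [Expr.eval, hyy, hys, hcon] at hyY
      refine Runs.seq (runs_of_loopFree rfl
        (Q := fun s'' t => s'' = s'.setCell .ys 0 y 0 ∧ t ≤ 4) ?_) ?_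
      · exact fun t ht => ⟨by simp [Cmd.apply, Expr.eval, hyy], ht⟩
      rintro s₂ t₂ hs₂ ⟨rfl, ht₂⟩
      have hc₂ : Current P m (Y.erase y) (s'.setCell .ys 0 y 0) := by
        refine ⟨hr'.of_sameOutside hs₂ rfl, ha', fun w => ?_⟩
        by_cases hwy : w = y
        · simp [hwy]
        · have : (w : ℕ) ≠ y := fun h => hwy (Fin.ext h)
          simp [hwy, this, hys]
      refine runs_buildPushUp_runDA hc₂ fun s₃ t₃ hs₃ hh ht₃ => ?_
      have hc₃ := hc₂.of_sameOutside hs₃ rfl rfl rfl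
      have hbest₃ : s₃.tab .best = s'.tab .best := (hs₃.2 _ rfl).trans (hs₂.2 _ rfl)
      refine Runs.seq (runs_compare hc₃.ready.n_eq) ?_
      rintro s₄ t₄ hs₄ ⟨hsame, ht₄⟩
      have hc₄ := hc₃.of_sameOutside hs₄ rfl rfl rfl
      have hy₄ : s₄.reg .y = y := by
        rw [hs₄.1 _ rfl, hs₃.1 _ rfl]
        exact hyy
      have hsame' : s₄.reg .same = 1 ↔
          daPushUp P m (Y.erase y) = daPushUp P m (noRegretSet P m) := by
        rw [hsame]
        simp only [hbest₃, hbest', hh, Fin.val_inj]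
        exact ⟨fun h => Equiv.symm_bijective.injective (Equiv.ext h), fun h w => by rw [h]⟩
      refine runs_of_loopFree rfl fun t ht => ?_
      have htime : BExpr.cost (.eq (at1 .ys (v .y)) (.const 1) : BExpr Reg Tab) + 1 +
          (t₂ + (t₃ + (t₄ + t))) ≤ 400 * (n * n) := by
        have h1 : t ≤ 16 := ht.trans (by decide)
        have h2 : BExpr.cost (.eq (at1 .ys (v .y)) (.const 1) : BExpr Reg Tab) = 5 := rfl
        omega
      by_cases heq : s₄.reg .same = 1
      · have hstate : Cmd.apply (.ite (.eq (v .same) (.const 1)) (.set .y (.const 0))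
            (put1 .ys (v .y) (.const 1) ;; .set .y (.succ (v .y)))) s₄ = s₄.setReg .y 0 := by
          simp [Cmd.apply, Expr.eval, heq]
        rw [hstate]
        refine ⟨⟨Y.erase y, hc₄.ys_eq, hreach.tail ⟨y, hyY', rfl, hsame'.1 heq⟩, by simp,
          fun w _ h => absurd h (by simp)⟩, ?_, htime⟩
        have hcard := Finset.card_erase_add_one hyY'
        have hys₄ : ∀ w : Fin n, (s₄.setReg .y 0).tab .ys 0 w = if w ∈ Y.erase y then 1 else 0 :=
          hc₄.ys_eq
        -- A removal lowers the first term by `n + 1`, while restarting raises `n - y` by at most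
        -- `n`.
        unfold greedyPotential
        rw [sum_ys hys₄, sum_ys hys, ← hcard, Nat.add_mul, State.setReg_reg, if_pos rfl]
        omega
      · have hstate : Cmd.apply (.ite (.eq (v .same) (.const 1)) (.set .y (.const 0))
            (put1 .ys (v .y) (.const 1) ;; .set .y (.succ (v .y)))) s₄ =
            (s₄.setCell .ys 0 y 1).setReg .y (y + 1) := by
          simp [Cmd.apply, Expr.eval, heq, hy₄]
        rw [hstate]
        have h := hnext ((s₄.setCell .ys 0 y 1).setReg .y (y + 1)) (by simp) (fun w => ?_)
          (fun _ h => heq (hsame'.2 h))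
        · exact ⟨h.1, h.2, htime⟩
        · by_cases hwy : w = y
          · simp [hwy, hyY']
          · have : (w : ℕ) ≠ y := fun h => hwy (Fin.ext h)
            simp [hwy, this, hc₄.ys_eq]
    · have hyY' : y ∉ Y := by
        intro hcon
        have h1 : ¬ (BExpr.eq (at1 .ys (v .y)) (.const 1)).eval s' = true := by rw [hyY]; simp
        simp [Expr.eval, hyy, hys, hcon] at h1
      refine runs_of_loopFree rfl fun t ht => ?_
      have hstate : Cmd.apply (.set .y (.succ (v .y))) s' = s'.setReg .y (y + 1) := by
        simp [Cmd.apply, Expr.eval, hyy]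
      rw [hstate]
      have h := hnext (s'.setReg .y (y + 1)) (by simp) hys (fun h => absurd h hyY')
      refine ⟨h.1, h.2, ?_⟩
      have h1 : t ≤ 3 := ht
      have h2 : BExpr.cost (.eq (at1 .ys (v .y)) (.const 1) : BExpr Reg Tab) = 5 := rfl
      omega
  · rintro s' t hs' ⟨⟨Y, hys, hreach, hyn, hfail⟩, hb, ht⟩
    have hr' := hc₁.ready.of_sameOutside hs' rfl
    have hy : s'.reg .y = n := by
      have h1 : ¬ (BExpr.lt (v .y) (v .n)).eval s' = true := by rw [hb]; simp
      simp only [BExpr.eval_lt_iff, Expr.eval, hr'.n_eq] at h1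
      omega
    refine ⟨Y, ⟨hr', (hs'.1 _ rfl).trans hc₁.a_eq, hys⟩, ⟨hreach, ?_⟩, ?_⟩
    · rintro Y' ⟨w, hw, rfl, heq⟩
      exact hfail w hw (by rw [hy]; exact w.2) heq
    · have hpot : greedyPotential n (s.setReg .y 0) ≤ n * (n + 1) + n := by
        unfold greedyPotential
        rw [sum_ys hc₁.ys_eq]
        have h1 : (noRegretSet P m).card ≤ n := (Finset.card_le_univ _).trans (by simp)
        exact Nat.add_le_add (Nat.mul_le_mul_right _ h1) (Nat.sub_le _ _)
      simp only [BExpr.cost, Expr.cost] at ht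
      have h1 : n ≤ n * n := Nat.le_mul_self n
      have h2 : n * n ≤ n * n * (n * n) := Nat.le_mul_self _
      have h3 := Nat.mul_le_mul_left (400 * (n * n) + 4) (hpot.trans
        (by nlinarith : n * (n + 1) + n ≤ 3 * (n * n)))
      have h4 : (400 * (n * n) + 4) * (3 * (n * n)) =
          1200 * (n * n * n * n) + 12 * (n * n) := by ring
      have h5 : n * n * (n * n) = n * n * n * n := by ring
      have h6 : (400 * (n * n) + (1 + 1 + 1) + 1) = 400 * (n * n) + 4 := by ring
      rw [h6] at ht
      have h7 := Nat.zero_le ((400 * (n * n) + 4) * greedyPotential n s')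
      omega

theorem runs_main {n : ℕ} (P : Profile n) (m : Fin n) :
    Runs main (initState P m) (fun s t => ∃ Y, Outputs s Y (pushUp P m Y) ∧
      GreedyReturns P m Y ∧ t ≤ 5000 * n ^ 4) := by
  have hpos : 0 < n := Fin.pos m
  refine Runs.seq (runs_prepare P m) ?_
  rintro s₁ t₁ - ⟨hr₁, hl₁, ht₁⟩
  refine Runs.seq (runs_runDA hr₁ hl₁) ?_
  rintro s₂ t₂ hs₂ ⟨hh₂, ht₂⟩
  rw [misreport_self] at hh₂
  have hr₂ := hr₁.of_sameOutside hs₂ rfl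
  refine Runs.seq (runs_findPartner hr₂.n_eq hr₂.acc_eq hh₂ (Or.inl rfl)) ?_
  rintro s₃ t₃ hs₃ ⟨ha₃, ht₃⟩
  have hr₃ := hr₂.of_sameOutside hs₃ rfl
  refine Runs.seq (runs_computeNoRegretSet hr₃ ha₃) ?_
  rintro s₄ t₄ hs₄ ⟨hnr₄, ht₄⟩
  have hr₄ := hr₃.of_sameOutside hs₄ rfl
  have ha₄ := (hs₄.1 .a rfl).trans ha₃
  refine Runs.seq (runs_for (N := Reg.n) (by decide) rfl rfl
    (fun k (s' : State Reg Tab) => ∀ w : Fin n, (w : ℕ) < k →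
      s'.tab .ys 0 w = if w ∈ noRegretSet P m then 1 else 0) 6 ?_ ?_) ?_
  · exact fun _ h => absurd h (Nat.not_lt_zero _)
  · intro k s' _ hs' hk hI
    have hnr : s'.tab .nr = s₄.tab .nr := hs'.2 _ rfl
    refine runs_of_loopFree rfl fun t ht => ⟨fun w hw => ?_, ht.trans (by decide)⟩
    by_cases hwk : (w : ℕ) = k
    · simp [Cmd.apply, Expr.eval, hk, hnr, ← hwk, hnr₄]
    · simpa [Cmd.apply, Expr.eval, hk, hwk] using hI w (by omega)
  rintro s₅ t₅ hs₅ ⟨hys₅, ht₅⟩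
  have hr₅ := hr₄.of_sameOutside hs₅ rfl
  rw [hr₄.n_eq] at hys₅ ht₅
  have hc₅ : Current P m (noRegretSet P m) s₅ :=
    ⟨hr₅, (hs₅.1 .a rfl).trans ha₄, fun w => hys₅ w w.2⟩
  refine runs_buildPushUp_runDA hc₅ fun s₆ t₆ hs₆ hh₆ ht₆ => ?_
  have hc₆ := hc₅.of_sameOutside hs₆ rfl rfl rfl
  refine Runs.seq (runs_for (N := Reg.n) (by decide) rfl rfl
    (fun k (s' : State Reg Tab) => ∀ w : Fin n, (w : ℕ) < k →
      s'.tab .best 0 w = (daPushUp P m (noRegretSet P m)).symm w) 6 ?_ ?_) ?_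
  · exact fun _ h => absurd h (Nat.not_lt_zero _)
  · intro k s' _ hs' hk hI
    have hh : s'.tab .husb = s₆.tab .husb := hs'.2 _ rfl
    refine runs_of_loopFree rfl fun t ht => ⟨fun w hw => ?_, ht.trans (by decide)⟩
    by_cases hwk : (w : ℕ) = k
    · simp [Cmd.apply, Expr.eval, hk, hh, ← hwk, hh₆]
    · simpa [Cmd.apply, Expr.eval, hk, hwk] using hI w (by omega)
  rintro s₇ t₇ hs₇ ⟨hbest₇, ht₇⟩
  have hc₇ := hc₆.of_sameOutside hs₇ rfl rfl rfl
  rw [hc₆.ready.n_eq] at hbest₇ ht₇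
  refine Runs.seq (runs_greedyLoop hc₇ fun w => hbest₇ w w.2) ?_
  rintro s₈ t₈ - ⟨Y, hc₈, hY, ht₈⟩
  refine (runs_buildPushUp hc₈).mono ?_
  rintro s₉ t₉ hs₉ ⟨hL, ht₉⟩
  refine ⟨Y, ⟨(hc₈.of_sameOutside hs₉ rfl rfl rfl).ys_eq, hL⟩, hY, ?_⟩
  have h1 : n ≤ n * n := Nat.le_mul_self n
  have h2 : n * n ≤ n * n * n := Nat.le_mul_of_pos_right _ hpos
  have h3 : n * n * n ≤ n * n * n * n := Nat.le_mul_of_pos_right _ hpos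
  have h4 : n ^ 4 = n * n * n * n := by ring
  omega

end Program

end StableMarriage

open StableMarriage
theorem mainTheorem5 :
    -- correctness of the greedy algorithm, whatever the order of the removals
    (∀ (n : ℕ) (P : Profile n) (m : Fin n) (Y : Finset (Fin n)), GreedyReturns P m Y →
      IsMinimumNoRegretPushUpSet P m Y ∧ IsMinimumOptimal P m (pushUp P m Y)) ∧
    -- the program runs the greedy algorithm, in time `O(n ^ 4)`
    ∃ C : ℕ, ∀ (n : ℕ) (P : Profile n) (m : Fin n),
      ∃ (Y : Finset (Fin n)) (s : State Reg Tab) (t : ℕ),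
        Exec Program.main (initState P m) s t ∧ t ≤ C * n ^ 4 ∧
        Outputs s Y (pushUp P m Y) ∧ GreedyReturns P m Y ∧
        IsMinimumNoRegretPushUpSet P m Y ∧ IsMinimumOptimal P m (pushUp P m Y) := by
  have hcorrect : ∀ (n : ℕ) (P : Profile n) (m : Fin n) (Y : Finset (Fin n)),
      GreedyReturns P m Y →
      IsMinimumNoRegretPushUpSet P m Y ∧ IsMinimumOptimal P m (pushUp P m Y) :=
    fun _ _ _ _ h => ⟨h.isMinimumNoRegretPushUpSet, h.isMinimumNoRegretPushUpSet.isMinimumOptimal⟩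
  refine ⟨hcorrect, 5000, fun n P m => ?_⟩
  obtain ⟨s, t, he, Y, hout, hY, ht⟩ := Program.runs_main P m
  exact ⟨Y, s, t, he, ht, hout, hY, hcorrect n P m Y hY⟩
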